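/- Consider Painlevé's first equation (P1), $y''=6y^2+z$, in the complex domain. (i) Let $U\subseteq\mathbb{C}$ be a nonempty connected open set and let $y$ be an analytic function on $U$ with $y''(z)=6y(z)^2+z$ for all $z\in U$. Then there is a meromorphic function $Y$ on all of $\mathbb{C}$ with $Y=y$ on $U$, such that $Y''=6Y^2+z$ at every point where $Y$ is analytic, and every other point of $\mathbb{C}$ is a pole of $Y$ of order exactly two. That is, every solution of P1 extends meromorphically to $\mathbb{C}$, and its only singularities are double poles. (ii) For every $p\in\mathbb{C}$ there is a one-parameter family of solutions of P1 with a double pole at $p$: for every $c\in\mathbb{C}$ there is a function $A$, analytic at $p$, with $A(p)=1$ and $A^{(6)}(p)=6!\,c$, such that $h(z)=(z-p)^{-2}A(z)$ satisfies P1 in a punctured neighbourhood of $p$. (So $c$ is the coefficient of $(z-p)^4$ in the Laurent expansion of $h$ at $p$.) (iii) A solution with a double pole is determined by the pole and that coefficient: if $A$ and $B$ are analytic at $p$ with $A(p)\neq0$, $B(p)\neq0$ and $A^{(6)}(p)=B^{(6)}(p)$, and both $(z-p)^{-2}A(z)$ and $(z-p)^{-2}B(z)$ satisfy P1 in a punctured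 neighbourhood of $p$, then $A=B$ in a neighbourhood of $p$. -/

import Mathlib

/-- `y` is an (analytic) solution on `U ⊆ ℂ` of the first Painlevé equation `y'' = 6 y² + z`:
`y` is analytic at each point of `U` and satisfies the equation there. -/
def IsPainleveISolutionOn (y : ℂ → ℂ) (U : Set ℂ) : Prop :=
  AnalyticOnNhd ℂ y U ∧ ∀ z ∈ U, deriv (deriv y) z = 6 * y z ^ 2 + z

/-- `z ↦ A z / (z - p)²`, with `A` analytic at `p`, solves the first Painlevé equation on some
punctured disk centred at `p`. -/
def IsPainleveISolutionNearPole (p : ℂ) (A : ℂ → ℂ) : Prop :=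
  AnalyticAt ℂ A p ∧ ∃ r : ℝ, 0 < r ∧
    IsPainleveISolutionOn (fun z => A z / (z - p) ^ 2) (Metric.ball p r \ {p})

/-! The Painlevé property rests on an energy estimate. For a solution, `W = y'² - 4y³ - 2zy`
satisfies `W' = -2y`, so `W` grows like `2/(z - p)` at a double pole `p`. Adding `y' ȳ / (1 +
|y|²)`, which behaves like `y'/y` there but stays smooth at zeros of `y`, cancels this growth. The
corrected energy changes at a rate at most linear in itself (`norm_energy_rate_le`), so Grönwall
bounds it along pole-free segments in a bounded region.

Bounded energy means bounded initial data in one of two charts: `(y, y')` where `|y| ≤ 1`, and `(u,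
v)` with `y = u⁻²` where `|y| ≥ 1`. The equation is polynomial in both, also at `u = 0`, where `y`
has a double pole. Picard's theorem therefore continues the solution to a ball whose radius does not
depend on the point (`exists_uniform_radius_painleveISolution`). Finitely many enlargements fill any
given disk, and the disks are glued.

For (ii), start the `(u, v)` system at `u(p) = 0`; the free value `v(p)` is a multiple of `c`. For
(iii), `A - B` solves a linear equation with a regular singular point at `p` and indicial polynomial
`(m - 6)(m + 1)`; equality of the sixth derivatives excludes order 6, hence `A = B` near `p`. -/

open Filter Topology Metric

/-! ### Picard's theorem in the complex domain, with uniform radius. -/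

/-- One step of Picard iteration in the complex domain: on a ball of radius `r` the primitive of
`z ↦ F (z, g z)` with value `w₀` at the centre stays within distance `1` of `w₀`. -/
theorem exists_picard_step {E : Type*} [NormedAddCommGroup E] [NormedSpace ℂ E] [CompleteSpace E]
    {F : ℂ × E → E} (hF : Differentiable ℂ F) {z₀ : ℂ} {w₀ : E} {r L : ℝ} (hr : 0 < r)
    (hr1 : r ≤ 1) (hL : ∀ z ∈ closedBall z₀ 1, ∀ w ∈ closedBall w₀ 1, ‖F (z, w)‖ ≤ L)
    (hrL : r * L ≤ 1) {g : ℂ → E} (hg : DifferentiableOn ℂ g (ball z₀ r))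
    (hgm : ∀ z ∈ ball z₀ r, g z ∈ closedBall w₀ 1) :
    ∃ G : ℂ → E, (∀ z ∈ ball z₀ r, HasDerivAt G (F (z, g z)) z) ∧ G z₀ = w₀ ∧
      ∀ z ∈ ball z₀ r, G z ∈ closedBall w₀ 1 := by
  have hd : DifferentiableOn ℂ (fun z => F (z, g z)) (ball z₀ r) :=
    hF.comp_differentiableOn (differentiableOn_id.prodMk hg)
  obtain ⟨G, hG0, hG⟩ := hd.isExactOn_ball.with_val_at z₀ w₀
  refine ⟨G, hG, hG0, fun z hz => ?_⟩
  have h1 : ‖G z - G z₀‖ ≤ L * ‖z - z₀‖ :=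
    (convex_ball z₀ r).norm_image_sub_le_of_norm_hasDerivWithin_le
      (fun x hx => (hG x hx).hasDerivWithinAt)
      (fun x hx => hL x (ball_subset_closedBall (ball_subset_ball hr1 hx)) _ (hgm x hx))
      (mem_ball_self hr) hz
  have hL0 : 0 ≤ L := (norm_nonneg _).trans
    (hL z₀ (mem_closedBall_self zero_le_one) w₀ (mem_closedBall_self zero_le_one))
  rw [mem_closedBall, dist_eq_norm, ← hG0]
  have h2 : ‖z - z₀‖ ≤ r := by rw [← dist_eq_norm]; exact (mem_ball.1 hz).le
  nlinarith

/-- Picard's existence theorem in the complex domain. -/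
theorem exists_hasDerivAt_of_lipschitz {E : Type*} [NormedAddCommGroup E] [NormedSpace ℂ E]
    [CompleteSpace E] {F : ℂ × E → E} (hF : Differentiable ℂ F) {z₀ : ℂ} {w₀ : E} {r L K : ℝ}
    (hr : 0 < r) (hr1 : r ≤ 1) (hL : ∀ z ∈ closedBall z₀ 1, ∀ w ∈ closedBall w₀ 1, ‖F (z, w)‖ ≤ L)
    (hK : ∀ z ∈ closedBall z₀ 1, ∀ w ∈ closedBall w₀ 1, ∀ w' ∈ closedBall w₀ 1,
      ‖F (z, w) - F (z, w')‖ ≤ K * ‖w - w'‖)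
    (hK0 : 0 ≤ K) (hrL : r * L ≤ 1) (hrK : r * K ≤ 1 / 2) :
    ∃ w : ℂ → E, w z₀ = w₀ ∧ ∀ z ∈ ball z₀ r, HasDerivAt w (F (z, w z)) z := by
  let X := {g : ℂ → E // DifferentiableOn ℂ g (ball z₀ r) ∧
    ∀ z ∈ ball z₀ r, g z ∈ closedBall w₀ 1}
  have step : ∀ g : X, ∃ G : X, (∀ z ∈ ball z₀ r, HasDerivAt G.1 (F (z, g.1 z)) z) ∧
      G.1 z₀ = w₀ := fun g => by
    obtain ⟨G, h1, h2, h3⟩ := exists_picard_step hF hr hr1 hL hrL g.2.1 g.2.2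
    exact ⟨⟨G, fun z hz => (h1 z hz).differentiableAt.differentiableWithinAt, h3⟩, h1, h2⟩
  choose T hT hT0 using step
  let x₀ : X := ⟨fun _ => w₀, differentiableOn_const _, fun _ _ => mem_closedBall_self zero_le_one⟩
  let s : ℕ → X := fun n => T^[n] x₀
  have hs : ∀ n, s (n + 1) = T (s n) := fun n => Function.iterate_succ_apply' T n x₀
  have hb : ball z₀ r ⊆ closedBall z₀ 1 :=
    (ball_subset_ball hr1).trans ball_subset_closedBall
  -- Consecutive iterates agree at the centre, so their distance is at most `r` times a bound on the
  -- difference of derivatives; `r * K ≤ 1 / 2` makes this a contraction.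
  have contr : ∀ n, ∀ z ∈ ball z₀ r, dist ((s n).1 z) ((s (n + 1)).1 z) ≤ 1 * (1 / 2) ^ n := by
    intro n
    induction n with
    | zero =>
      intro z hz
      simpa [s, x₀, dist_comm] using (s 1).2.2 z hz
    | succ n ih =>
      intro z hz
      rw [hs (n + 1), hs n, dist_comm, dist_eq_norm]
      have hd : ∀ x ∈ ball z₀ r, HasDerivWithinAt
          (fun x => (T (T (s n))).1 x - (T (s n)).1 x)
          (F (x, (T (s n)).1 x) - F (x, (s n).1 x)) (ball z₀ r) x := fun x hx =>
        ((hT _ x hx).sub (hT _ x hx)).hasDerivWithinAt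
      have h1 := (convex_ball z₀ r).norm_image_sub_le_of_norm_hasDerivWithin_le
        (C := K * (1 / 2) ^ n) hd (fun x hx => by
          refine (hK x (hb hx) _ ((T (s n)).2.2 x hx) _ ((s n).2.2 x hx)).trans ?_
          have := ih x hx
          rw [hs n, dist_comm, dist_eq_norm, one_mul] at this
          gcongr) (mem_ball_self hr) hz
      simp only [hT0, sub_self, sub_zero] at h1
      refine h1.trans ?_
      have h2 : ‖z - z₀‖ ≤ r := by rw [← dist_eq_norm]; exact (mem_ball.1 hz).le
      calc K * (1 / 2) ^ n * ‖z - z₀‖ ≤ K * (1 / 2) ^ n * r := by gcongr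
        _ = (r * K) * (1 / 2) ^ n := by ring
        _ ≤ 1 / 2 * (1 / 2) ^ n := by gcongr
        _ = 1 * (1 / 2) ^ (n + 1) := by ring
  have lim : ∀ z, ∃ l, z ∈ ball z₀ r → Tendsto (fun n => (s n).1 z) atTop (𝓝 l) := fun z => by
    by_cases hz : z ∈ ball z₀ r
    · obtain ⟨l, hl⟩ := cauchySeq_tendsto_of_complete
        (cauchySeq_of_le_geometric (1 / 2) 1 (by norm_num) (fun n => contr n z hz))
      exact ⟨l, fun _ => hl⟩
    · exact ⟨0, fun h => absurd h hz⟩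
  choose w hw using lim
  have unif : TendstoUniformlyOn (fun n => (s n).1) w atTop (ball z₀ r) := by
    rw [Metric.tendstoUniformlyOn_iff]
    intro ε hε
    have : Tendsto (fun n : ℕ => 1 * (1 / 2 : ℝ) ^ n / (1 - 1 / 2)) atTop (𝓝 0) := by
      simpa using ((tendsto_pow_atTop_nhds_zero_of_lt_one (r := (1 / 2 : ℝ)) (by norm_num)
        (by norm_num)).const_mul 1).div_const (1 - 1 / 2)
    filter_upwards [this.eventually_lt_const hε] with n hn z hz
    rw [dist_comm]
    exact (dist_le_of_le_geometric_of_tendsto (1 / 2) 1 (by norm_num)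
      (fun n => contr n z hz) (hw z hz) n).trans_lt hn
  have hdiff : ∀ᶠ n in atTop, DifferentiableOn ℂ (s n).1 (ball z₀ r) :=
    Eventually.of_forall fun n => (s n).2.1
  have hwd := unif.tendstoLocallyUniformlyOn.differentiableOn hdiff isOpen_ball
  refine ⟨w, ?_, fun z hz => ?_⟩
  · refine tendsto_nhds_unique (hw z₀ (mem_ball_self hr)) ?_
    rw [← tendsto_add_atTop_iff_nat 1]
    simp only [hs, hT0]
    exact tendsto_const_nhds
  -- Derivatives of locally uniformly convergent holomorphic functions converge too, so the equation
  -- passes to the limit directly.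
  · have h1 := (unif.tendstoLocallyUniformlyOn.deriv hdiff isOpen_ball).tendsto_at hz
    rw [← tendsto_add_atTop_iff_nat 1] at h1
    have h2 : Tendsto (fun n => F (z, (s n).1 z)) atTop (𝓝 (F (z, w z))) :=
      (hF.continuous.tendsto _).comp (tendsto_const_nhds.prodMk_nhds (hw z hz))
    have h3 : deriv w z = F (z, w z) := by
      refine tendsto_nhds_unique h1 (h2.congr fun n => ?_)
      simp only [Function.comp, hs]
      exact ((hT _ z hz).deriv).symm
    rw [← h3]
    exact (hwd.differentiableAt (isOpen_ball.mem_nhds hz)).hasDerivAt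

/-- The radius of existence in Picard's theorem is uniform for initial data in a bounded set. -/
theorem exists_uniform_radius_hasDerivAt {E : Type*} [NormedAddCommGroup E] [NormedSpace ℂ E]
    [ProperSpace E] {F : ℂ × E → E} (hF : ContDiff ℂ 1 F) (M B : ℝ) :
    ∃ r : ℝ, 0 < r ∧ ∀ (z₀ : ℂ) (w₀ : E), ‖z₀‖ ≤ M → ‖w₀‖ ≤ B →
      ∃ w : ℂ → E, w z₀ = w₀ ∧ ∀ z ∈ ball z₀ r, HasDerivAt w (F (z, w z)) z := by
  have hcomp : IsCompact (closedBall (0 : ℂ) (M + 1) ×ˢ closedBall (0 : E) (B + 1)) :=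
    (isCompact_closedBall _ _).prod (isCompact_closedBall _ _)
  obtain ⟨L, hL⟩ := hcomp.exists_bound_of_continuousOn hF.continuous.continuousOn
  obtain ⟨K, hK⟩ := hcomp.exists_bound_of_continuousOn
    (hF.continuous_fderiv one_ne_zero).continuousOn
  have hpos : 0 < 1 + 2 * |L| + 2 * |K| := by positivity
  have hK2 : (0 : ℝ) ≤ |K| := abs_nonneg K
  have hL2 : (0 : ℝ) ≤ |L| := abs_nonneg L
  -- This radius is at most `1`, and its products with `|L|` and `|K|` are at most `1 / 2`.
  refine ⟨(1 + 2 * |L| + 2 * |K|)⁻¹, inv_pos.2 hpos, fun z₀ w₀ hz₀ hw₀ => ?_⟩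
  have hzs : ∀ z ∈ closedBall z₀ 1, z ∈ closedBall (0 : ℂ) (M + 1) := fun z hz => by
    rw [mem_closedBall_zero_iff]
    rw [mem_closedBall, dist_eq_norm] at hz
    linarith [norm_le_norm_add_norm_sub' z z₀]
  have hws : ∀ w ∈ closedBall w₀ 1, w ∈ closedBall (0 : E) (B + 1) := fun w hw => by
    rw [mem_closedBall_zero_iff]
    rw [mem_closedBall, dist_eq_norm] at hw
    linarith [norm_le_norm_add_norm_sub' w w₀]
  refine exists_hasDerivAt_of_lipschitz (L := |L|) (K := |K|)
    (hF.differentiable one_ne_zero) (inv_pos.2 hpos)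
    (inv_le_one_of_one_le₀ (by linarith)) (fun z hz w hw => ?_) (fun z hz w hw w' hw' => ?_)
    (abs_nonneg K) ?_ ?_
  · exact (hL (z, w) ⟨hzs z hz, hws w hw⟩).trans (le_abs_self L)
  · have hconv : Convex ℝ (closedBall (0 : ℂ) (M + 1) ×ˢ closedBall (0 : E) (B + 1)) := by
      let : NormedSpace ℝ E := NormedSpace.restrictScalars ℝ ℂ E
      exact (convex_closedBall _ _).prod (convex_closedBall _ _)
    have := hconv.norm_image_sub_le_of_norm_fderiv_le (𝕜 := ℂ) (f := F) (C := |K|)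
      (fun x _ => hF.differentiable one_ne_zero x)
      (fun x hx => (hK x hx).trans (le_abs_self K))
      (x := (z, w')) (y := (z, w)) ⟨hzs z hz, hws w' hw'⟩ ⟨hzs z hz, hws w hw⟩
    refine this.trans_eq ?_
    simp [Prod.norm_def]
  · rw [inv_mul_le_iff₀ hpos]; linarith
  · rw [inv_mul_le_iff₀ hpos]; linarith

/-! ### Regular singular points and the indicial equation. -/

/-- The Euler operator `(z - p) d/dz` applied to `(z - p) ^ m * g`. -/
theorem sub_mul_deriv_eventuallyEq {p : ℂ} {D g : ℂ → ℂ} {m : ℕ} (hg : AnalyticAt ℂ g p)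
    (h : D =ᶠ[𝓝 p] fun z => (z - p) ^ m * g z) :
    (fun z => (z - p) * deriv D z) =ᶠ[𝓝 p]
      fun z => (z - p) ^ m * (m * g z + (z - p) * deriv g z) := by
  filter_upwards [h.deriv, hg.eventually_analyticAt] with z hz hgz
  have h1 : HasDerivAt (fun z => (z - p) ^ m * g z)
      (m * (z - p) ^ (m - 1) * 1 * g z + (z - p) ^ m * deriv g z) z :=
    (((hasDerivAt_id z).sub_const p).pow m).mul hgz.differentiableAt.hasDerivAt
  rw [hz, h1.deriv]
  rcases m with _ | m
  · simp
  · simp only [Nat.add_sub_cancel]; ring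

/-- The order of vanishing at a regular singular point is a root of the indicial equation. -/
theorem eventually_eq_zero_or_indicial {p : ℂ} {D β : ℂ → ℂ} {α : ℂ} (hD : AnalyticAt ℂ D p)
    (hβ : ContinuousAt β p)
    (h : ∀ᶠ z in 𝓝[≠] p, (z - p) ^ 2 * deriv (deriv D) z + α * ((z - p) * deriv D z)
      + β z * D z = 0) :
    (∀ᶠ z in 𝓝 p, D z = 0) ∨ ∃ m : ℕ, analyticOrderAt D p = m ∧
      (m : ℂ) * (m - 1) + α * m + β p = 0 := by
  by_cases htop : analyticOrderAt D p = ⊤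
  · exact Or.inl (analyticOrderAt_eq_top.1 htop)
  obtain ⟨m, hm⟩ := ENat.ne_top_iff_exists.1 htop
  refine Or.inr ⟨m, hm.symm, ?_⟩
  obtain ⟨g, hg, hgp, hDg⟩ := (hD.analyticOrderAt_eq_natCast).1 hm.symm
  simp only [smul_eq_mul] at hDg
  have h1 := sub_mul_deriv_eventuallyEq hg hDg
  set g₁ : ℂ → ℂ := fun z => m * g z + (z - p) * deriv g z with hg₁
  have hg₁a : AnalyticAt ℂ g₁ p := by
    have := hg.deriv
    fun_prop
  have h2 := sub_mul_deriv_eventuallyEq hg₁a h1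
  set g₂ : ℂ → ℂ := fun z => m * g₁ z + (z - p) * deriv g₁ z with hg₂
  have hg₂a : AnalyticAt ℂ g₂ p := by
    have := hg₁a.deriv
    fun_prop
  -- With `θ = (z - p) d/dz` one has `(z - p)² D'' = θ²D - θD`; the common factor `(z - p) ^ m` is
  -- cancelled, and letting `z → p` gives the indicial polynomial times `g p`.
  have hev : ∀ᶠ z in 𝓝[≠] p, g₂ z - g₁ z + α * g₁ z + β z * g z = 0 := by
    filter_upwards [h, self_mem_nhdsWithin, nhdsWithin_le_nhds h1, nhdsWithin_le_nhds h2,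
      nhdsWithin_le_nhds hDg, nhdsWithin_le_nhds hD.eventually_analyticAt]
      with z hz hzp hz1 hz2 hz0 hza
    have hne : (z - p) ^ m ≠ 0 := pow_ne_zero _ (sub_ne_zero.2 hzp)
    have h3 : HasDerivAt (fun z => (z - p) * deriv D z)
        (1 * deriv D z + (z - p) * deriv (deriv D) z) z :=
      ((hasDerivAt_id z).sub_const p).mul hza.deriv.differentiableAt.hasDerivAt
    rw [h3.deriv] at hz2
    refine (mul_eq_zero.1 ?_).resolve_left hne
    linear_combination hz - hz2 + (1 - α) * hz1 - β z * hz0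
  have hcont : ContinuousAt (fun z => g₂ z - g₁ z + α * g₁ z + β z * g z) p := by
    have := hg₂a.continuousAt
    have := hg₁a.continuousAt
    have := hg.continuousAt
    fun_prop
  have h0 : g₂ p - g₁ p + α * g₁ p + β p * g p = 0 :=
    tendsto_nhds_unique (hcont.tendsto.mono_left nhdsWithin_le_nhds)
      (tendsto_const_nhds.congr' (by filter_upwards [hev] with z hz using hz.symm))
  have e1 : g₁ p = m * g p := by simp [hg₁]
  have e2 : g₂ p = m * (m * g p) := by simp [hg₂, e1]
  rw [e1, e2] at h0
  exact (mul_eq_zero.1 (by linear_combination h0 :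
    ((m : ℂ) * (m - 1) + α * m + β p) * g p = 0)).resolve_right hgp

/-! ### Meromorphic solutions: identity theorem, gluing, initial data. -/

/-- `f` is a meromorphic solution of the first Painlevé equation at `z`: either it is analytic at
`z` and satisfies the equation there, or it has a double pole at `z`, where it takes the value
`0`. -/
def IsPainleveISolutionAt (f : ℂ → ℂ) (z : ℂ) : Prop :=
  (AnalyticAt ℂ f z ∧ deriv (deriv f) z = 6 * f z ^ 2 + z) ∨
    (f z = 0 ∧ meromorphicOrderAt f z = ((-2 : ℤ) : WithTop ℤ))

namespace IsPainleveISolutionAt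

variable {f g : ℂ → ℂ} {z : ℂ}

theorem congr (hf : IsPainleveISolutionAt f z) (h : f =ᶠ[𝓝 z] g) : IsPainleveISolutionAt g z := by
  rcases hf with ⟨h1, h2⟩ | ⟨h1, h2⟩
  · exact Or.inl ⟨h1.congr h, by rw [← h.deriv.deriv.eq_of_nhds, ← h.eq_of_nhds, h2]⟩
  · refine Or.inr ⟨by rw [← h.eq_of_nhds, h1], ?_⟩
    rw [← meromorphicOrderAt_congr (h.filter_mono nhdsWithin_le_nhds), h2]

theorem meromorphicAt (hf : IsPainleveISolutionAt f z) : MeromorphicAt f z := by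
  rcases hf with ⟨h1, h2⟩ | ⟨h1, h2⟩
  · exact h1.meromorphicAt
  · exact meromorphicAt_of_meromorphicOrderAt_ne_zero (by rw [h2]; decide)

theorem meromorphicOrderAt_eq (hf : IsPainleveISolutionAt f z) (ha : ¬ AnalyticAt ℂ f z) :
    meromorphicOrderAt f z = ((-2 : ℤ) : WithTop ℤ) :=
  (hf.resolve_left fun h => ha h.1).2

theorem deriv_deriv (hf : IsPainleveISolutionAt f z) (ha : AnalyticAt ℂ f z) :
    deriv (deriv f) z = 6 * f z ^ 2 + z := by
  rcases hf with ⟨h1, h2⟩ | ⟨h1, h2⟩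
  · exact h2
  · have := ha.meromorphicOrderAt_nonneg
    rw [h2] at this
    exact absurd this (by decide)

/-- Meromorphy gives equality only off `z`. At `z` the orders agree, so both functions are regular
there and continuity applies, or both have a pole and the normalised value `0`. -/
theorem eq_of_frequently_eq (hf : IsPainleveISolutionAt f z) (hg : IsPainleveISolutionAt g z)
    (h : ∃ᶠ w in 𝓝[≠] z, f w = g w) : f =ᶠ[𝓝 z] g := by
  have h1 : f =ᶠ[𝓝[≠] z] g :=
    (hf.meromorphicAt.frequently_eq_iff_eventuallyEq hg.meromorphicAt).1 h
  have key : f z = g z := by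
    have ho := meromorphicOrderAt_congr h1
    rcases hf with ⟨hfa, _⟩ | ⟨hf0, hfo⟩ <;> rcases hg with ⟨hga, _⟩ | ⟨hg0, hgo⟩
    · exact tendsto_nhds_unique (hfa.continuousAt.tendsto.mono_left nhdsWithin_le_nhds)
        ((hga.continuousAt.tendsto.mono_left nhdsWithin_le_nhds).congr' h1.symm)
    · have := hfa.meromorphicOrderAt_nonneg
      rw [ho, hgo] at this
      exact absurd this (by decide)
    · have := hga.meromorphicOrderAt_nonneg
      rw [← ho, hfo] at this
      exact absurd this (by decide)
    · rw [hf0, hg0]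
  exact eventuallyEq_nhds_of_eventuallyEq_nhdsNE h1 key

end IsPainleveISolutionAt

/-- The identity theorem for meromorphic solutions. -/
theorem IsPainleveISolutionAt.eqOn_of_isPreconnected {f g : ℂ → ℂ} {U : Set ℂ}
    (hU : IsPreconnected U) (hf : ∀ z ∈ U, IsPainleveISolutionAt f z)
    (hg : ∀ z ∈ U, IsPainleveISolutionAt g z) {b : ℂ} (hb : b ∈ U) (h : f =ᶠ[𝓝 b] g) :
    Set.EqOn f g U := by
  have hsub : U ⊆ {z | f =ᶠ[𝓝 z] g} := by
    refine hU.subset_of_closure_inter_subset isOpen_setOfPred_eventually_nhds ⟨b, hb, h⟩ ?_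
    rintro z ⟨hz, hzU⟩
    refine (hf z hzU).eq_of_frequently_eq (hg z hzU) ?_
    intro hev
    have h2 : ∀ᶠ w in 𝓝[≠] z, ¬ f =ᶠ[𝓝 w] g := by
      filter_upwards [hev] with w hw hw' using hw hw'.eq_of_nhds
    by_cases hzS : f =ᶠ[𝓝 z] g
    · exact (hev.and (hzS.filter_mono nhdsWithin_le_nhds)).exists.elim fun w hw => hw.1 hw.2
    · rw [eventually_nhdsWithin_iff] at h2
      obtain ⟨w, hw1, hw2⟩ := ((mem_closure_iff_frequently.1 hz).and_eventually h2).exists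
      by_cases hwz : w = z
      · exact hzS (hwz ▸ hw1)
      · exact hw2 hwz hw1
  exact fun z hz => (hsub hz).eq_of_nhds

/-- Compatible meromorphic solutions on open sets can be glued. -/
theorem IsPainleveISolutionAt.exists_glue {ι : Type*} (U : ι → Set ℂ) (f : ι → ℂ → ℂ)
    (hU : ∀ i, IsOpen (U i)) (hf : ∀ i, ∀ z ∈ U i, IsPainleveISolutionAt (f i) z)
    (hc : ∀ i j, ∀ z ∈ U i, z ∈ U j → f i z = f j z) :
    ∃ F : ℂ → ℂ, (∀ i, Set.EqOn F (f i) (U i)) ∧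
      ∀ z, (∃ i, z ∈ U i) → IsPainleveISolutionAt F z := by
  classical
  let F : ℂ → ℂ := fun z => if h : ∃ i, z ∈ U i then f h.choose z else 0
  have hF : ∀ i, Set.EqOn F (f i) (U i) := fun i z hz => by
    have h : ∃ i, z ∈ U i := ⟨i, hz⟩
    simp only [F, dif_pos h]
    exact hc _ _ z h.choose_spec hz
  refine ⟨F, hF, fun z ⟨i, hi⟩ => (hf i z hi).congr ?_⟩
  filter_upwards [(hU i).mem_nhds hi] with w hw using (hF i hw).symm

/-- A solution is determined by its initial data at a regular point. -/
theorem IsPainleveISolutionAt.eventuallyEq_of_initial {f g : ℂ → ℂ} {b : ℂ}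
    (hf : ∀ᶠ z in 𝓝 b, IsPainleveISolutionAt f z) (hg : ∀ᶠ z in 𝓝 b, IsPainleveISolutionAt g z)
    (hfa : AnalyticAt ℂ f b) (hga : AnalyticAt ℂ g b) (h0 : f b = g b)
    (h1 : deriv f b = deriv g b) : f =ᶠ[𝓝 b] g := by
  have hD : AnalyticAt ℂ (fun z => f z - g z) b := hfa.fun_sub hga
  -- Multiplied by `(z - b)²`, the linear equation for `f - g` has `α = 0` and `β b = 0`, hence
  -- indicial roots `0` and `1`, while the initial data force order at least `2`.
  have hβ : ContinuousAt (fun z => -6 * (z - b) ^ 2 * (f z + g z)) b := by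
    have := hfa.continuousAt
    have := hga.continuousAt
    fun_prop
  have hd : ∀ᶠ z in 𝓝 b, deriv (fun z => f z - g z) z = deriv f z - deriv g z := by
    filter_upwards [hfa.eventually_analyticAt, hga.eventually_analyticAt] with z h2 h3
    exact deriv_fun_sub h2.differentiableAt h3.differentiableAt
  have hode : ∀ᶠ z in 𝓝[≠] b, (z - b) ^ 2 * deriv (deriv (fun z => f z - g z)) z
      + 0 * ((z - b) * deriv (fun z => f z - g z) z)
      + (fun z => -6 * (z - b) ^ 2 * (f z + g z)) z * (fun z => f z - g z) z = 0 := by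
    refine Eventually.filter_mono nhdsWithin_le_nhds ?_
    filter_upwards [hfa.eventually_analyticAt, hga.eventually_analyticAt, hf, hg,
      EventuallyEq.deriv hd] with z h2 h3 h4 h5 h6
    rw [h6, deriv_fun_sub h2.deriv.differentiableAt h3.deriv.differentiableAt, h4.deriv_deriv h2,
      h5.deriv_deriv h3]
    ring
  rcases eventually_eq_zero_or_indicial hD hβ hode with h | ⟨m, hm, hi⟩
  · filter_upwards [h] with z hz using sub_eq_zero.1 hz
  · exfalso
    have h2 : ((2 : ℕ) : ℕ∞) ≤ analyticOrderAt (fun z => f z - g z) b := by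
      rw [natCast_le_analyticOrderAt_iff_iteratedDeriv_eq_zero hD]
      intro i hi
      interval_cases i
      · simp [h0]
      · rw [iteratedDeriv_one, hd.self_of_nhds, h1, sub_self]
    rw [hm] at h2
    have h3 : 2 ≤ m := by exact_mod_cast h2
    have h4 : (m : ℂ) * ((m : ℂ) - 1) = 0 := by simpa using hi
    rcases mul_eq_zero.1 h4 with h | h
    · have : m = 0 := by exact_mod_cast h
      omega
    · have : m = 1 := by exact_mod_cast sub_eq_zero.1 h
      omega

/-! ### The energy and its growth along segments. -/

/-- The Hamiltonian `b² - 4a³ - 2za` of the first Painlevé equation, at `y = a`, `y' = b`, with the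
correction `b * conj a / (1 + |a|²)`, which cancels its singular part at the poles. -/
noncomputable def painleveEnergy (z a b : ℂ) : ℂ :=
  b ^ 2 - 4 * a ^ 3 - 2 * z * a + b * star a / (1 + a * star a)

theorem one_add_mul_star (a : ℂ) : 1 + a * star a = ((1 + ‖a‖ ^ 2 : ℝ) : ℂ) := by
  rw [Complex.star_def, Complex.mul_conj']
  push_cast
  ring

theorem one_add_mul_star_ne_zero (a : ℂ) : 1 + a * star a ≠ 0 := by
  rw [one_add_mul_star]
  exact_mod_cast (by positivity : (1 + ‖a‖ ^ 2 : ℝ) ≠ 0)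

theorem norm_one_add_mul_star (a : ℂ) : ‖1 + a * star a‖ = 1 + ‖a‖ ^ 2 := by
  rw [one_add_mul_star, Complex.norm_real, Real.norm_of_nonneg (by positivity)]

theorem norm_hamiltonian_le (z a b : ℂ) :
    ‖b ^ 2 - 4 * a ^ 3 - 2 * z * a‖ ≤ ‖painleveEnergy z a b‖ + ‖b‖ * ‖a‖ / (1 + ‖a‖ ^ 2) := by
  have h : b ^ 2 - 4 * a ^ 3 - 2 * z * a
      = painleveEnergy z a b - b * star a / (1 + a * star a) := by
    rw [painleveEnergy]; ring
  have h1 := norm_sub_le (painleveEnergy z a b) (b * star a / (1 + a * star a))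
  rw [← h, norm_div, norm_mul, norm_star, norm_one_add_mul_star] at h1
  exact h1

theorem norm_sq_le_hamiltonian {M : ℝ} {z : ℂ} (hz : ‖z‖ ≤ M) (a b : ℂ) :
    ‖b‖ ^ 2 ≤ ‖b ^ 2 - 4 * a ^ 3 - 2 * z * a‖ + 4 * ‖a‖ ^ 3 + 2 * M * ‖a‖ := by
  have h : b ^ 2 = (b ^ 2 - 4 * a ^ 3 - 2 * z * a) + 4 * a ^ 3 + 2 * z * a := by ring
  rw [← norm_pow]
  conv_lhs => rw [h]
  refine (norm_add₃_le).trans ?_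
  simp only [norm_mul, norm_pow, Complex.norm_ofNat]
  gcongr

/-- Here `x`, `B`, `w`, `v` stand for `|y|`, `|y'|`, `|W|` and the modulus of the energy. With `T =
w / s` and `t = B / s`, the hypotheses become `t² ≤ T + 4 + 2M` and `T ≤ v + t / 2`. Since `t ≤ (t²
+ 1) / 2`, the first can be absorbed into the second, so `T` is bounded linearly in `v`, as Grönwall
requires. -/
theorem energy_rate_real_bound {x B w v M : ℝ} (hx : 0 ≤ x) (hB : 0 ≤ B) (hw : 0 ≤ w)
    (hv : 0 ≤ v) (hM : 0 ≤ M) (h1 : B ^ 2 ≤ w + 4 * x ^ 3 + 2 * M * x)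
    (h2 : w ≤ v + B * x / (1 + x ^ 2)) :
    x * (2 * (1 + x ^ 2)) / (1 + x ^ 2) ^ 2 + M * x / (1 + x ^ 2)
      + (2 * M * x + w) * x ^ 2 / (1 + x ^ 2) ^ 2 + B ^ 2 / (1 + x ^ 2) ^ 2
      ≤ 2 * v + (7 + 6 * M) := by
  set s := 1 + x ^ 2 with hs
  have hs1 : 1 ≤ s := by nlinarith
  have hs0 : 0 < s := by linarith
  have hxs : 2 * x ≤ s := by nlinarith [sq_nonneg (x - 1)]
  set T := w / s with hT
  set t := B / s with ht
  have hwT : w = T * s := by rw [hT]; field_simp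
  have hBt : B = t * s := by rw [ht]; field_simp
  have hT0 : 0 ≤ T := by positivity
  have ht0 : 0 ≤ t := by positivity
  have hx3 : x ^ 3 ≤ s ^ 2 := by
    have : x ^ 3 ≤ x ^ 2 * s := by nlinarith [sq_nonneg x]
    have : x ^ 2 * s ≤ s ^ 2 := by nlinarith
    linarith
  have hxs2 : x ≤ s ^ 2 := by nlinarith
  have hts : t ^ 2 ≤ T + 4 + 2 * M := by
    have e : t ^ 2 * s ^ 2 ≤ (T + 4 + 2 * M) * s ^ 2 := by
      have e1 : t ^ 2 * s ^ 2 = B ^ 2 := by rw [hBt]; ring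
      have e2 : w ≤ T * s ^ 2 := by rw [hwT]; nlinarith [mul_nonneg hT0 hs0.le]
      have e3 : 2 * M * x ≤ 2 * M * s ^ 2 := by gcongr
      nlinarith
    exact le_of_mul_le_mul_right e (by positivity)
  have hTv : T ≤ v + t / 2 := by
    have e : B * x / s = t * x := by rw [ht]; ring
    rw [e] at h2
    have e2 : T * s ≤ (v + t / 2) * s := by
      rw [← hwT]
      nlinarith [mul_nonneg hv (sub_nonneg.2 hs1), mul_nonneg ht0 (sub_nonneg.2 hxs)]
    exact le_of_mul_le_mul_right e2 hs0
  have hTf : T ≤ 2 * v + 2 + M := by nlinarith [sq_nonneg (t - 1)]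
  have a1 : x * (2 * s) / s ^ 2 ≤ 1 := by
    rw [div_le_one (by positivity)]; nlinarith
  have a2 : M * x / s ≤ M := by
    rw [div_le_iff₀ hs0]; nlinarith
  have a3 : (2 * M * x + w) * x ^ 2 / s ^ 2 + B ^ 2 / s ^ 2 ≤ T + 4 + 4 * M := by
    rw [← add_div, div_le_iff₀ (by positivity)]
    have e1 : w * x ^ 2 + w = T * s ^ 2 := by rw [hwT, hs]; ring
    have e2 : 2 * M * x * x ^ 2 ≤ 2 * M * s ^ 2 := by
      have : 2 * M * x * x ^ 2 = 2 * M * x ^ 3 := by ring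
      rw [this]; gcongr
    have e3 : 2 * M * x ≤ 2 * M * s ^ 2 := by gcongr
    nlinarith
  linarith

/-- The rate of change of the energy, along a path with velocity `d`, is controlled by the energy
itself. -/
theorem norm_energy_rate_le {M : ℝ} {z : ℂ} (hz : ‖z‖ ≤ M) (d a b : ℂ) :
    ‖-2 * d * a + d * (6 * a ^ 2 + z) * star a / (1 + a * star a)
      - d * b ^ 2 * star a ^ 2 / (1 + a * star a) ^ 2
      + star d * (b * star b) / (1 + a * star a) ^ 2‖
      ≤ ‖d‖ * (2 * ‖painleveEnergy z a b‖ + (7 + 6 * M)) := by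
  have hM : 0 ≤ M := (norm_nonneg z).trans hz
  refine le_trans ?_ (mul_le_mul_of_nonneg_left (energy_rate_real_bound (norm_nonneg a)
    (norm_nonneg b) (norm_nonneg (b ^ 2 - 4 * a ^ 3 - 2 * z * a)) (norm_nonneg _) hM
    (norm_sq_le_hamiltonian hz a b) (norm_hamiltonian_le z a b)) (norm_nonneg d))
  set W := b ^ 2 - 4 * a ^ 3 - 2 * z * a with hW
  have hS := one_add_mul_star_ne_zero a
  have hn := norm_one_add_mul_star a
  have hS4 : ‖2 * (1 + a * star a) - 4‖ ≤ 2 * (1 + ‖a‖ ^ 2) := by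
    rw [one_add_mul_star]
    have : (2 * ((1 + ‖a‖ ^ 2 : ℝ) : ℂ) - 4) = ((2 * (1 + ‖a‖ ^ 2) - 4 : ℝ) : ℂ) := by
      push_cast; ring
    rw [this, Complex.norm_real, Real.norm_eq_abs, abs_le]
    constructor <;> nlinarith [sq_nonneg ‖a‖]
  -- Substituting `b² = W + 4a³ + 2za` into the term with `star a ^ 2` lets the parts linear in `a`
  -- at infinity cancel, leaving the factor `2S - 4` over `S²`, where `S = 1 + a * star a`.
  have e : -2 * d * a + d * (6 * a ^ 2 + z) * star a / (1 + a * star a)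
      - d * b ^ 2 * star a ^ 2 / (1 + a * star a) ^ 2
      + star d * (b * star b) / (1 + a * star a) ^ 2
      = d * (a * (2 * (1 + a * star a) - 4) / (1 + a * star a) ^ 2)
        + d * (z * star a / (1 + a * star a))
        + d * (-(2 * z * a + W) * star a ^ 2 / (1 + a * star a) ^ 2)
        + star d * (b * star b / (1 + a * star a) ^ 2) := by
    rw [hW]
    field_simp
    ring
  rw [e]
  refine (norm_add_le _ _).trans ?_
  refine (add_le_add_left (norm_add₃_le) _).trans ?_
  simp only [norm_mul, norm_div, norm_pow, norm_neg, norm_star, hn]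
  rw [show ∀ p q r t : ℝ, ‖d‖ * (p + q + r + t) = ‖d‖ * p + ‖d‖ * q + ‖d‖ * r + ‖d‖ * t from
    fun p q r t => by ring, sq ‖b‖]
  have h3 : ‖2 * z * a + W‖ ≤ 2 * M * ‖a‖ + ‖W‖ := by
    refine (norm_add_le _ _).trans ?_
    simp only [norm_mul, Complex.norm_ofNat]
    gcongr
  gcongr

/-- The energy of a solution along a segment free of poles is bounded in terms of its initial
value. -/
theorem norm_painleveEnergy_le_gronwallBound {f : ℂ → ℂ} {z₀ d : ℂ} {M T : ℝ} (hd : ‖d‖ ≤ T)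
    (ha : ∀ s ∈ Set.Icc (0 : ℝ) 1, AnalyticAt ℂ f (z₀ + s * d))
    (hode : ∀ s ∈ Set.Icc (0 : ℝ) 1,
      deriv (deriv f) (z₀ + s * d) = 6 * f (z₀ + s * d) ^ 2 + (z₀ + s * d))
    (hM : ∀ s ∈ Set.Icc (0 : ℝ) 1, ‖z₀ + s * d‖ ≤ M) :
    ‖painleveEnergy (z₀ + d) (f (z₀ + d)) (deriv f (z₀ + d))‖ ≤
      gronwallBound ‖painleveEnergy z₀ (f z₀) (deriv f z₀)‖ (T * 2) (T * (7 + 6 * M)) 1 := by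
  have hM0 : 0 ≤ M := (norm_nonneg _).trans (hM 0 (by simp))
  have hder : ∀ s ∈ Set.Icc (0 : ℝ) 1, HasDerivAt (fun s : ℝ => painleveEnergy (z₀ + s * d)
      (f (z₀ + s * d)) (deriv f (z₀ + s * d)))
      (-2 * d * f (z₀ + s * d) + d * (6 * f (z₀ + s * d) ^ 2 + (z₀ + s * d)) *
        star (f (z₀ + s * d)) / (1 + f (z₀ + s * d) * star (f (z₀ + s * d)))
      - d * deriv f (z₀ + s * d) ^ 2 * star (f (z₀ + s * d)) ^ 2 /
        (1 + f (z₀ + s * d) * star (f (z₀ + s * d))) ^ 2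
      + star d * (deriv f (z₀ + s * d) * star (deriv f (z₀ + s * d))) /
        (1 + f (z₀ + s * d) * star (f (z₀ + s * d))) ^ 2) s := fun s hs => by
    have hz : HasDerivAt (fun s : ℝ => z₀ + s * d) d s := by
      simpa using ((Complex.ofRealCLM.hasDerivAt (x := s)).mul_const d).const_add z₀
    have hf : HasDerivAt (fun s : ℝ => f (z₀ + s * d)) (deriv f (z₀ + s * d) * d) s :=
      (ha s hs).differentiableAt.hasDerivAt.comp s hz
    have hf' : HasDerivAt (fun s : ℝ => deriv f (z₀ + s * d))
        (deriv (deriv f) (z₀ + s * d) * d) s :=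
      HasDerivAt.comp (h₂ := deriv f) s (ha s hs).deriv.differentiableAt.hasDerivAt hz
    rw [hode s hs] at hf'
    have hS := one_add_mul_star_ne_zero (f (z₀ + s * d))
    have hst := hf.star
    have := (((hf'.pow 2).sub ((hf.pow 3).const_mul 4)).sub ((hz.const_mul 2).mul hf)).add
      ((hf'.mul hst).div ((hf.mul hst).const_add 1) hS)
    refine this.congr_deriv ?_
    simp only [Pi.mul_apply, star_mul']
    field_simp
    ring
  have := norm_le_gronwallBound_of_norm_deriv_right_le
    (f := fun s : ℝ => painleveEnergy (z₀ + s * d) (f (z₀ + s * d)) (deriv f (z₀ + s * d)))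
    (a := 0) (b := 1) (δ := ‖painleveEnergy z₀ (f z₀) (deriv f z₀)‖) (K := T * 2)
    (ε := T * (7 + 6 * M))
    (fun s hs => (hder s hs).continuousAt.continuousWithinAt)
    (fun s hs => (hder s (Set.Ico_subset_Icc_self hs)).hasDerivWithinAt) (by simp)
    (fun s hs => by
      refine (norm_energy_rate_le (hM s (Set.Ico_subset_Icc_self hs)) d _ _).trans ?_
      rw [mul_assoc, ← mul_add]
      gcongr) 1 (by simp)
  simpa using this

/-! ### The regular chart and the pole chart. -/

theorem IsPainleveISolutionAt.of_hasDerivAt_system {U : Set ℂ} (hU : IsOpen U) {y p : ℂ → ℂ}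
    (hy : ∀ z ∈ U, HasDerivAt y (p z) z) (hp : ∀ z ∈ U, HasDerivAt p (6 * y z ^ 2 + z) z)
    {z : ℂ} (hz : z ∈ U) :
    IsPainleveISolutionAt y z ∧ AnalyticAt ℂ y z ∧ deriv y z = p z := by
  have ha : AnalyticAt ℂ y z :=
    DifferentiableOn.analyticAt (fun w hw => (hy w hw).differentiableAt.differentiableWithinAt)
      (hU.mem_nhds hz)
  refine ⟨Or.inl ⟨ha, ?_⟩, ha, (hy z hz).deriv⟩
  have : deriv y =ᶠ[𝓝 z] p := by
    filter_upwards [hU.mem_nhds hz] with w hw using (hy w hw).deriv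
  rw [this.deriv_eq, (hp z hz).deriv]

/-- The factor `k` in the regularisation `y = u⁻²`, `y' = -2 u⁻³ (1 + u⁴ k)` of the first Painlevé
equation near its poles. -/
noncomputable def painlevePoleFactor (z u v : ℂ) : ℂ := z / 4 + u / 4 + u ^ 2 * v

/-- The first Painlevé equation in the coordinates `(u, v)`, in which it is regular at the poles. -/
noncomputable def painlevePoleField (q : ℂ × ℂ × ℂ) : ℂ × ℂ :=
  (1 + q.2.1 ^ 4 * painlevePoleFactor q.1 q.2.1 q.2.2,
    -q.2.1 * painlevePoleFactor q.1 q.2.1 q.2.2 *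
      (q.1 / 4 + q.2.1 / 2 + 3 * q.2.1 ^ 2 * q.2.2))

theorem contDiff_painlevePoleField : ContDiff ℂ 1 painlevePoleField := by
  unfold painlevePoleField painlevePoleFactor
  fun_prop

section PoleChart

variable {U : Set ℂ} {u v : ℂ → ℂ}

theorem hasDerivAt_inv_sq_of_poleField {z : ℂ}
    (hu : HasDerivAt u (1 + u z ^ 4 * painlevePoleFactor z (u z) (v z)) z) (h0 : u z ≠ 0) :
    HasDerivAt (fun z => (u z ^ 2)⁻¹)
      (-2 * (1 + u z ^ 4 * painlevePoleFactor z (u z) (v z)) / u z ^ 3) z := by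
  refine ((hu.pow 2).inv (pow_ne_zero 2 h0)).congr_deriv ?_
  simp only [Pi.pow_apply]
  field_simp
  ring

/-- At a zero of `u` the system forces `u' = 1`, so `u⁻²` has a double pole, and `0⁻¹ = 0` supplies
the normalised value. Elsewhere the field is the equation for `y = u⁻²` rewritten. -/
theorem IsPainleveISolutionAt.of_poleField (hU : IsOpen U)
    (hu : ∀ z ∈ U, HasDerivAt u (1 + u z ^ 4 * painlevePoleFactor z (u z) (v z)) z)
    (hv : ∀ z ∈ U, HasDerivAt v (-u z * painlevePoleFactor z (u z) (v z) *
      (z / 4 + u z / 2 + 3 * u z ^ 2 * v z)) z) {z : ℂ} (hz : z ∈ U) :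
    IsPainleveISolutionAt (fun z => (u z ^ 2)⁻¹) z := by
  have hua : AnalyticAt ℂ u z :=
    DifferentiableOn.analyticAt (fun w hw => (hu w hw).differentiableAt.differentiableWithinAt)
      (hU.mem_nhds hz)
  by_cases h0 : u z = 0
  · refine Or.inr ⟨by simp [h0], ?_⟩
    have h1 : analyticOrderAt u z = 1 := by
      refine hua.analyticOrderAt_eq_one_of_zero_deriv_ne_zero h0 ?_
      rw [(hu z hz).deriv, h0]
      simp
    have h2 : meromorphicOrderAt u z = 1 := by
      rw [hua.meromorphicOrderAt_eq, h1]; rfl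
    have h3 := meromorphicOrderAt_inv (f := u ^ 2) (x := z)
    rw [meromorphicOrderAt_pow hua.meromorphicAt, h2] at h3
    exact h3
  · refine Or.inl ⟨(hua.pow 2).inv (pow_ne_zero 2 h0), ?_⟩
    have h1 : deriv (fun z => (u z ^ 2)⁻¹) =ᶠ[𝓝 z]
        fun z => -2 * (1 + u z ^ 4 * painlevePoleFactor z (u z) (v z)) / u z ^ 3 := by
      filter_upwards [hU.mem_nhds hz, hua.continuousAt.eventually_ne h0] with w hw hw0
      exact (hasDerivAt_inv_sq_of_poleField (hu w hw) hw0).deriv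
    rw [h1.deriv_eq]
    have hu' := hu z hz
    have hv' := hv z hz
    have hk : HasDerivAt (fun z => painlevePoleFactor z (u z) (v z)) _ z :=
      (((hasDerivAt_id z).div_const 4).add (hu'.div_const 4)).add ((hu'.pow 2).mul hv')
    have h2 := ((((hu'.pow 4).mul hk).const_add 1).const_mul (-2)).div (hu'.pow 3)
      (pow_ne_zero 3 h0)
    refine (HasDerivAt.deriv h2).trans ?_
    simp only [Pi.pow_apply, Pi.mul_apply]
    simp only [painlevePoleFactor]
    field_simp
    ring

end PoleChart

/-- The quotient is the coordinate `v` when `g = 1 + u⁴k`. As `Re g ≥ 0`, the factor `g + 1` in `(g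
- 1)(g + 1) = z u⁴ / 2 + W u⁶ / 4` is bounded below, so `g - 1 = O(u⁴)`. Bounded energy then gives
`W = 2 / u + O(1)`, and `v = (W - 2 / u) / 8 - (g - 1)² / (2u⁶)` is bounded. -/
theorem norm_poleCoordinate_le {M N : ℝ} {z u g : ℂ} (hz : ‖z‖ ≤ M) (hu0 : u ≠ 0)
    (hu : ‖u‖ ≤ 1) (hg : 0 ≤ g.re)
    (hN : ‖painleveEnergy z (u ^ 2)⁻¹ (-2 * g / u ^ 3)‖ ≤ N) :
    ‖(g - 1 - z * u ^ 4 / 4 - u ^ 5 / 4) / u ^ 6‖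
      ≤ (N + 4 * (M + N / 2 + 1) + 2) / 8 + (M + N / 2 + 1) ^ 2 / 2 := by
  set a := (u ^ 2)⁻¹ with ha
  set b := -2 * g / u ^ 3 with hb
  set W := b ^ 2 - 4 * a ^ 3 - 2 * z * a with hW
  set H := M + N / 2 + 1 with hH
  set ρ := ‖u‖ with hρ
  have hρ0 : 0 < ρ := norm_pos_iff.2 hu0
  have hM0 : 0 ≤ M := (norm_nonneg _).trans hz
  have hN0 : 0 ≤ N := (norm_nonneg _).trans hN
  have hH1 : 1 ≤ H := by rw [hH]; linarith
  have hna : ‖a‖ = (ρ ^ 2)⁻¹ := by rw [ha, norm_inv, norm_pow]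
  have hnb : ‖b‖ = 2 * ‖g‖ / ρ ^ 3 := by rw [hb]; simp [hρ]
  have hgh : ‖g‖ ≤ 1 + ‖g - 1‖ := by
    have := norm_add_le (1 : ℂ) (g - 1)
    simpa using this
  have hfrac : ‖b‖ * ‖a‖ / (1 + ‖a‖ ^ 2) = 2 * ‖g‖ / ρ / (1 + ρ ^ 4) := by
    rw [hna, hnb]; field_simp; ring
  have hWn : ‖W‖ ≤ N + 2 * ‖g‖ / ρ := by
    have h1 := norm_hamiltonian_le z a b
    rw [hfrac] at h1
    have h2 : 2 * ‖g‖ / ρ / (1 + ρ ^ 4) ≤ 2 * ‖g‖ / ρ :=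
      div_le_self (by positivity) (by linarith [pow_pos hρ0 4])
    linarith
  have hg2 : (g - 1) * (g + 1) = z * u ^ 4 / 2 + W * u ^ 6 / 4 := by
    rw [hW, ha, hb]
    field_simp
    ring
  have hg1 : 1 ≤ ‖g + 1‖ := by
    refine le_trans ?_ (Complex.re_le_norm _)
    simp [hg]
  have hh0 : ‖g - 1‖ ≤ M * ρ ^ 4 / 2 + ‖W‖ * ρ ^ 6 / 4 := by
    calc ‖g - 1‖ ≤ ‖g - 1‖ * ‖g + 1‖ := le_mul_of_one_le_right (norm_nonneg _) hg1
      _ = ‖z * u ^ 4 / 2 + W * u ^ 6 / 4‖ := by rw [← norm_mul, hg2]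
      _ ≤ ‖z‖ * ρ ^ 4 / 2 + ‖W‖ * ρ ^ 6 / 4 := by
        refine (norm_add_le _ _).trans_eq ?_
        simp [hρ]
      _ ≤ _ := by gcongr
  -- The bound on `W` itself contains `‖g - 1‖`; that contribution is at most half of the left side
  -- and is absorbed, which doubles the constant to `H`.
  have hh : ‖g - 1‖ ≤ ρ ^ 4 * H := by
    have e1 : ‖W‖ * ρ ^ 6 ≤ N * ρ ^ 4 + 2 * (1 + ‖g - 1‖) * ρ ^ 4 := by
      calc ‖W‖ * ρ ^ 6 ≤ (N + 2 * ‖g‖ / ρ) * ρ ^ 6 := by gcongr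
        _ = (N * ρ ^ 2 + 2 * ‖g‖ * ρ) * ρ ^ 4 := by field_simp
        _ ≤ (N * 1 + 2 * (1 + ‖g - 1‖) * 1) * ρ ^ 4 := by
          have : ρ ^ 2 ≤ 1 := pow_le_one₀ hρ0.le hu
          gcongr
        _ = _ := by ring
    have e2 : ‖g - 1‖ * ρ ^ 4 ≤ ‖g - 1‖ :=
      mul_le_of_le_one_right (norm_nonneg _) (pow_le_one₀ hρ0.le hu)
    rw [hH]
    nlinarith
  have hgH : ‖g‖ ≤ 1 + H := by
    have : ρ ^ 4 * H ≤ H := mul_le_of_le_one_left (by linarith) (pow_le_one₀ hρ0.le hu)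
    linarith
  have hWu : ‖W - 2 / u‖ ≤ N + 4 * H + 2 := by
    have hS := one_add_mul_star_ne_zero a
    have e1 : W - 2 / u = painleveEnergy z a b + 2 * (g - 1) / u
        + b * u ^ 2 / (1 + a * star a) := by
      have h1 : b * star a / (1 + a * star a)
          = b * u ^ 2 - b * u ^ 2 / (1 + a * star a) := by
        have h2 : u ^ 2 * a = 1 := by rw [ha]; field_simp
        rw [eq_sub_iff_add_eq, ← add_div, div_eq_iff hS]
        linear_combination (-b * star a) * h2
      have h3 : b * u ^ 2 = -2 * g / u := by rw [hb]; field_simp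
      rw [painleveEnergy, ← hW, h1, h3]
      ring
    rw [e1]
    refine norm_add₃_le.trans ?_
    have t1 : ‖2 * (g - 1) / u‖ ≤ 2 * H := by
      rw [norm_div, norm_mul, Complex.norm_ofNat, div_le_iff₀ hρ0]
      have : ρ ^ 4 * H ≤ ρ * H := by
        gcongr
        exact pow_le_of_le_one hρ0.le hu (by norm_num)
      linarith
    have t2 : ‖b * u ^ 2 / (1 + a * star a)‖ ≤ 2 * (1 + H) := by
      rw [norm_div, norm_one_add_mul_star, norm_mul, norm_pow, hna, hnb, ← hρ]
      have : 2 * ‖g‖ / ρ ^ 3 * ρ ^ 2 / (1 + ((ρ ^ 2)⁻¹) ^ 2)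
          = 2 * ‖g‖ * ρ ^ 3 / (1 + ρ ^ 4) := by
        field_simp
        ring
      rw [this, div_le_iff₀ (by positivity)]
      calc 2 * ‖g‖ * ρ ^ 3 ≤ 2 * (1 + H) * 1 := by
            have : ρ ^ 3 ≤ 1 := pow_le_one₀ hρ0.le hu
            gcongr
        _ ≤ 2 * (1 + H) * (1 + ρ ^ 4) := by
            gcongr
            linarith [pow_pos hρ0 4]
    linarith
  have hveq : (g - 1 - z * u ^ 4 / 4 - u ^ 5 / 4) / u ^ 6
      = (W - 2 / u) / 8 - (g - 1) ^ 2 / u ^ 6 / 2 := by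
    field_simp
    field_simp at hg2
    linear_combination 4 * hg2
  rw [hveq]
  refine (norm_sub_le _ _).trans ?_
  have t3 : ‖(g - 1) ^ 2 / u ^ 6 / 2‖ ≤ H ^ 2 / 2 := by
    rw [norm_div, norm_div, norm_pow, norm_pow, Complex.norm_ofNat, ← hρ]
    gcongr
    rw [div_le_iff₀ (by positivity)]
    calc ‖g - 1‖ ^ 2 ≤ (ρ ^ 4 * H) ^ 2 := by gcongr
      _ = H ^ 2 * ρ ^ 6 * ρ ^ 2 := by ring
      _ ≤ H ^ 2 * ρ ^ 6 := mul_le_of_le_one_right (by positivity) (pow_le_one₀ hρ0.le hu)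
  rw [norm_div, Complex.norm_ofNat]
  linarith

/-- Initial data with a large value and bounded energy have bounded pole coordinates. -/
theorem exists_poleCoordinates {M N : ℝ} {z a b : ℂ} (hz : ‖z‖ ≤ M) (ha : 1 ≤ ‖a‖)
    (hN : ‖painleveEnergy z a b‖ ≤ N) :
    ∃ u v : ℂ, u ≠ 0 ∧ ‖u‖ ≤ 1 ∧
      ‖v‖ ≤ (N + 4 * (M + N / 2 + 1) + 2) / 8 + (M + N / 2 + 1) ^ 2 / 2 ∧
      a = (u ^ 2)⁻¹ ∧ b = -2 * (1 + u ^ 4 * painlevePoleFactor z u v) / u ^ 3 := by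
  have ha0 : a ≠ 0 := norm_pos_iff.1 (by linarith)
  -- Replacing `u` by `-u` changes the sign of `g = -b u³ / 2`, so one of the two square roots gives
  -- `Re g ≥ 0`.
  obtain ⟨u, hua, hre⟩ : ∃ u : ℂ, u ^ 2 = a⁻¹ ∧ 0 ≤ (-b * u ^ 3 / 2).re := by
    obtain ⟨u, hu⟩ := IsAlgClosed.exists_pow_nat_eq a⁻¹ two_pos
    rcases le_total 0 (-b * u ^ 3 / 2).re with h | h
    · exact ⟨u, hu, h⟩
    · refine ⟨-u, by rw [neg_sq, hu], ?_⟩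
      have : -b * (-u) ^ 3 / 2 = -(-b * u ^ 3 / 2) := by ring
      rw [this, Complex.neg_re]
      linarith
  have hu0 : u ≠ 0 := by
    rintro rfl
    simp [ha0, eq_comm] at hua
  have hau : a = (u ^ 2)⁻¹ := by rw [hua, inv_inv]
  have hu1 : ‖u‖ ≤ 1 := by
    have h1 : ‖u‖ ^ 2 ≤ 1 := by
      rw [← norm_pow, hua, norm_inv]
      exact inv_le_one_of_one_le₀ ha
    exact (sq_le_one_iff₀ (norm_nonneg u)).1 h1
  have hb : b = -2 * (-b * u ^ 3 / 2) / u ^ 3 := by field_simp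
  have hN' := hN
  rw [hb, hau] at hN'
  refine ⟨u, _, hu0, hu1, norm_poleCoordinate_le hz hu0 hu1 hre hN', hau, ?_⟩
  rw [painlevePoleFactor]
  field_simp
  ring

/-- For `‖a‖ ≤ 1` the energy is `b²` up to terms at most linear in `b`, so it controls `b`. -/
theorem norm_le_of_norm_painleveEnergy_le {M N : ℝ} {z a b : ℂ} (hz : ‖z‖ ≤ M) (ha : ‖a‖ ≤ 1)
    (hN : ‖painleveEnergy z a b‖ ≤ N) : ‖b‖ ≤ N + 2 * M + 5 := by
  have h1 := norm_sq_le_hamiltonian hz a b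
  have h2 := norm_hamiltonian_le z a b
  have hM0 : 0 ≤ M := (norm_nonneg _).trans hz
  have hN0 : 0 ≤ N := (norm_nonneg _).trans hN
  have h3 : ‖b‖ * ‖a‖ / (1 + ‖a‖ ^ 2) ≤ ‖b‖ := by
    rw [div_le_iff₀ (by positivity)]
    nlinarith [mul_nonneg (norm_nonneg b) (sq_nonneg ‖a‖), mul_nonneg (norm_nonneg b)
      (sub_nonneg.2 ha)]
  have h4 : ‖a‖ ^ 3 ≤ 1 := pow_le_one₀ (norm_nonneg a) ha
  have h5 : M * ‖a‖ ≤ M := mul_le_of_le_one_right hM0 ha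
  nlinarith [norm_nonneg b]

/-! ### Analytic continuation to the whole plane. -/

/-- Initial data of bounded energy belong to meromorphic solutions on balls of uniform radius. -/
theorem exists_uniform_radius_painleveISolution (M N : ℝ) :
    ∃ r : ℝ, 0 < r ∧ ∀ z₀ a b : ℂ, ‖z₀‖ ≤ M → ‖painleveEnergy z₀ a b‖ ≤ N →
      ∃ f : ℂ → ℂ, (∀ z ∈ ball z₀ r, IsPainleveISolutionAt f z) ∧ AnalyticAt ℂ f z₀ ∧
        f z₀ = a ∧ deriv f z₀ = b := by
  have hF : ContDiff ℂ 1 (fun q : ℂ × ℂ × ℂ => (q.2.2, 6 * q.2.1 ^ 2 + q.1)) := by fun_prop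
  obtain ⟨r₁, hr₁, H₁⟩ := exists_uniform_radius_hasDerivAt hF M (max 1 (N + 2 * M + 5))
  obtain ⟨r₂, hr₂, H₂⟩ := exists_uniform_radius_hasDerivAt contDiff_painlevePoleField M
    (max 1 ((N + 4 * (M + N / 2 + 1) + 2) / 8 + (M + N / 2 + 1) ^ 2 / 2))
  refine ⟨min r₁ r₂, lt_min hr₁ hr₂, fun z₀ a b hz hN => ?_⟩
  rcases le_total ‖a‖ 1 with ha | ha
  · obtain ⟨w, hw0, hw⟩ := H₁ z₀ (a, b) hz
      (max_le_max ha (norm_le_of_norm_painleveEnergy_le hz ha hN))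
    have key := fun z (hz : z ∈ ball z₀ r₁) =>
      IsPainleveISolutionAt.of_hasDerivAt_system (y := fun z => (w z).1) (p := fun z => (w z).2)
        isOpen_ball (fun z hz => (hw z hz).fst) (fun z hz => (hw z hz).snd) hz
    have k0 := key z₀ (mem_ball_self hr₁)
    refine ⟨fun z => (w z).1, fun z hz => (key z (ball_subset_ball (min_le_left _ _) hz)).1,
      k0.2.1, by simp [hw0], by rw [k0.2.2, hw0]⟩
  · obtain ⟨u, v, hu0, hu1, hv, hau, hbu⟩ := exists_poleCoordinates hz ha hN
    obtain ⟨w, hw0, hw⟩ := H₂ z₀ (u, v) hz (max_le_max hu1 hv)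
    have hu' := fun z (hz : z ∈ ball z₀ r₂) => (hw z hz).fst
    have hv' := fun z (hz : z ∈ ball z₀ r₂) => (hw z hz).snd
    have k0 := hasDerivAt_inv_sq_of_poleField (v := fun z => (w z).2)
      (hu' z₀ (mem_ball_self hr₂)) (by rwa [hw0])
    have hsol : ∀ z ∈ ball z₀ r₂, IsPainleveISolutionAt (fun z => ((w z).1 ^ 2)⁻¹) z :=
      fun z hz => IsPainleveISolutionAt.of_poleField (v := fun z => (w z).2) isOpen_ball hu' hv' hz
    refine ⟨fun z => ((w z).1 ^ 2)⁻¹,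
      fun z hz => hsol z (ball_subset_ball (min_le_right _ _) hz), ?_, by simp [hw0, hau], ?_⟩
    · rcases hsol z₀ (mem_ball_self hr₂) with h | h
      · exact h.1
      · simp [hw0, hu0] at h
    · rw [k0.deriv, hbu, hw0]

/-- Arbitrarily close to every point there are points which can be reached from the centre along a
segment free of poles. -/
theorem IsPainleveISolutionAt.exists_segment_analyticAt {f : ℂ → ℂ} {z₀ z : ℂ} {R ε : ℝ}
    (hf : ∀ z ∈ ball z₀ R, IsPainleveISolutionAt f z) (h0 : AnalyticAt ℂ f z₀)
    (hz : z ∈ ball z₀ R) (hε : 0 < ε) :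
    ∃ b ∈ ball z₀ R, dist z b < ε ∧
      ∀ s ∈ Set.Icc (0 : ℝ) 1, AnalyticAt ℂ f (z₀ + s * (b - z₀)) := by
  by_cases hzz : z = z₀
  · subst hzz
    exact ⟨z, hz, by simpa using hε, fun s _ => by simpa using h0⟩
  have hne : z - z₀ ≠ 0 := sub_ne_zero.2 hzz
  have hmer : MeromorphicOn f (ball z₀ R) := fun w hw => (hf w hw).meromorphicAt
  have hcount := hmer.countable_compl_analyticAt_inter
  set P := {z | AnalyticAt ℂ f z}ᶜ ∩ ball z₀ R with hP
  -- The endpoint is moved perpendicularly to `z + t i (z - z₀)`. A non-analytic point `q` on the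
  -- new segment has `(q - z₀) / (z - z₀) = s (1 + t i)`, which determines `t`; so only countably
  -- many `t` are bad.
  have hdense := (hcount.image fun p => ((p - z₀) / (z - z₀)).im / ((p - z₀) / (z - z₀)).re
    ).dense_compl ℝ
  have hcont : Continuous fun t : ℝ => z + t * ((z - z₀) * Complex.I) := by fun_prop
  have hopen : IsOpen ((fun t : ℝ => z + t * ((z - z₀) * Complex.I)) ⁻¹'
      (ball z₀ R ∩ ball z ε)) := (isOpen_ball.inter isOpen_ball).preimage hcont
  obtain ⟨t, ⟨ht2, ht3⟩, ht1⟩ := hdense.inter_open_nonempty _ hopen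
    ⟨0, by simpa [hε] using hz⟩
  refine ⟨z + t * ((z - z₀) * Complex.I), ht2, by rw [dist_comm]; exact ht3, fun s hs => ?_⟩
  by_contra hna
  have hs0 : s ≠ 0 := by
    rintro rfl
    simp [h0] at hna
  apply ht1
  refine ⟨z₀ + s * (z + t * ((z - z₀) * Complex.I) - z₀), ⟨hna, ?_⟩, ?_⟩
  · rw [mem_ball, dist_eq_norm] at ht2 ⊢
    rw [add_sub_cancel_left, norm_mul, Complex.norm_real, Real.norm_of_nonneg hs.1]
    exact (mul_le_of_le_one_left (norm_nonneg _) hs.2).trans_lt ht2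
  · have : (z₀ + s * (z + t * ((z - z₀) * Complex.I) - z₀) - z₀) / (z - z₀)
        = s + (s * t : ℝ) * Complex.I := by
      push_cast
      field_simp
      ring
    simp only [this]
    simp [hs0]

/-- A meromorphic solution on a ball extends to a larger ball, if near each point of a dense set
it extends to a ball of radius `r`. -/
theorem IsPainleveISolutionAt.exists_extension {f : ℂ → ℂ} {z₀ : ℂ} {R r : ℝ} {S : Set ℂ}
    (hR : 0 < R) (hr : 0 < r) (hf : ∀ z ∈ ball z₀ R, IsPainleveISolutionAt f z)
    (hSR : S ⊆ ball z₀ R) (hS : ∀ z ∈ ball z₀ R, ∃ b ∈ S, dist z b < r / 2)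
    (hloc : ∀ b ∈ S, ∃ g : ℂ → ℂ, (∀ z ∈ ball b r, IsPainleveISolutionAt g z) ∧ f =ᶠ[𝓝 b] g) :
    ∃ F : ℂ → ℂ, (∀ z ∈ ball z₀ (R + r / 2), IsPainleveISolutionAt F z) ∧
      Set.EqOn F f (ball z₀ R) := by
  choose! g hg hfg using hloc
  have hfgU : ∀ b ∈ S, Set.EqOn f (g b) (ball z₀ R ∩ ball b r) := fun b hb =>
    IsPainleveISolutionAt.eqOn_of_isPreconnected
      ((convex_ball z₀ R).inter (convex_ball b r)).isPreconnected (fun z hz => hf z hz.1)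
      (fun z hz => hg b hb z hz.2) ⟨hSR hb, mem_ball_self hr⟩ (hfg b hb)
  have hgg : ∀ b ∈ S, ∀ c ∈ S, Set.EqOn (g b) (g c) (ball b r ∩ ball c r) := by
    rintro b hb c hc z ⟨hzb, hzc⟩
    have hbc : dist b c < 2 * r := by
      have := dist_triangle_left b c z
      rw [mem_ball] at hzb hzc
      linarith
    -- If two of the balls meet, the midpoint of their centres lies in both and in the original
    -- ball, where both extensions agree with `f`.
    have hmb : midpoint ℝ b c ∈ ball b r := by
      rw [mem_ball, dist_midpoint_left, Real.norm_ofNat]; linarith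
    have hmc : midpoint ℝ b c ∈ ball c r := by
      rw [mem_ball, dist_midpoint_right, Real.norm_ofNat]; linarith
    have hmR : midpoint ℝ b c ∈ ball z₀ R :=
      (convex_ball z₀ R).midpoint_mem (hSR hb) (hSR hc)
    refine IsPainleveISolutionAt.eqOn_of_isPreconnected
      ((convex_ball b r).inter (convex_ball c r)).isPreconnected (fun z hz => hg b hb z hz.1)
      (fun z hz => hg c hc z hz.2) ⟨hmb, hmc⟩ ?_ ⟨hzb, hzc⟩
    filter_upwards [isOpen_ball.mem_nhds hmb, isOpen_ball.mem_nhds hmc,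
      isOpen_ball.mem_nhds hmR] with w h1 h2 h3
    rw [← hfgU b hb ⟨h3, h1⟩, ← hfgU c hc ⟨h3, h2⟩]
  obtain ⟨F, hF, hFs⟩ := IsPainleveISolutionAt.exists_glue
    (fun i : Option S => i.elim (ball z₀ R) fun b => ball b.1 r)
    (fun i : Option S => i.elim f fun b => g b.1)
    (by rintro (_ | b) <;> exact isOpen_ball)
    (by
      rintro (_ | b) z hz
      · exact hf z hz
      · exact hg b.1 b.2 z hz)
    (by
      rintro (_ | b) (_ | c) z hz hz'
      · rfl
      · exact hfgU c.1 c.2 ⟨hz, hz'⟩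
      · exact (hfgU b.1 b.2 ⟨hz', hz⟩).symm
      · exact hgg b.1 b.2 c.1 c.2 ⟨hz, hz'⟩)
  refine ⟨F, fun z hz => hFs z ?_, hF none⟩
  have hpos : 0 < R + r / 2 := by positivity
  -- Radial contraction brings `z` into the original ball at a cost of less than `r / 2`; a point of
  -- `S` is then less than another `r / 2` away.
  have hz' : z₀ + (R / (R + r / 2) : ℝ) * (z - z₀) ∈ ball z₀ R := by
    rw [mem_ball, dist_eq_norm, add_sub_cancel_left, norm_mul, Complex.norm_real,
      Real.norm_of_nonneg (by positivity), ← dist_eq_norm, div_mul_eq_mul_div, div_lt_iff₀ hpos]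
    exact mul_lt_mul_of_pos_left hz hR
  have hzz' : dist z (z₀ + (R / (R + r / 2) : ℝ) * (z - z₀)) < r / 2 := by
    have e : z - (z₀ + (R / (R + r / 2) : ℝ) * (z - z₀))
        = ((r / 2 / (R + r / 2) : ℝ) : ℂ) * (z - z₀) := by
      have : r / 2 / (R + r / 2) = 1 - R / (R + r / 2) := by field_simp; ring
      rw [this]
      push_cast
      ring
    rw [dist_eq_norm, e, norm_mul, Complex.norm_real, Real.norm_of_nonneg (by positivity),
      ← dist_eq_norm, div_mul_eq_mul_div, div_lt_iff₀ hpos]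
    exact mul_lt_mul_of_pos_left hz (by positivity)
  obtain ⟨b, hb, hbz⟩ := hS _ hz'
  refine ⟨some ⟨b, hb⟩, ?_⟩
  have := dist_triangle z (z₀ + (R / (R + r / 2) : ℝ) * (z - z₀)) b
  change dist z b < r
  linarith

/-- A local solution extends to a meromorphic solution on every ball. -/
theorem IsPainleveISolutionAt.exists_on_ball {y : ℂ → ℂ} {z₀ : ℂ} (hya : AnalyticAt ℂ y z₀)
    (hy : ∀ᶠ z in 𝓝 z₀, IsPainleveISolutionAt y z) (T : ℝ) :
    ∃ f : ℂ → ℂ, (∀ z ∈ ball z₀ T, IsPainleveISolutionAt f z) ∧ f =ᶠ[𝓝 z₀] y := by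
  obtain ⟨ρ, hρ, hyρ⟩ := Metric.eventually_nhds_iff_ball.1 hy
  set T' := max T ρ with hT'
  have hρT : ρ ≤ T' := le_max_right _ _
  -- The energy bound always comes from segments starting at `z₀` inside the disk of radius `T'`, so
  -- it does not deteriorate and the same `r` serves every enlargement.
  obtain ⟨r, hr, hloc⟩ := exists_uniform_radius_painleveISolution (‖z₀‖ + T')
    (gronwallBound ‖painleveEnergy z₀ (y z₀) (deriv y z₀)‖ (T' * 2)
      (T' * (7 + 6 * (‖z₀‖ + T'))) 1)
  have key : ∀ n : ℕ, ∃ f : ℂ → ℂ,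
      (∀ z ∈ ball z₀ (min T' (ρ + n * (r / 2))), IsPainleveISolutionAt f z) ∧
        f =ᶠ[𝓝 z₀] y := by
    intro n
    induction n with
    | zero =>
      exact ⟨y, fun z hz => hyρ z (ball_subset_ball (by simp) hz), EventuallyEq.rfl⟩
    | succ n ih =>
      obtain ⟨f, hf, hfy⟩ := ih
      set R := min T' (ρ + n * (r / 2)) with hR
      have hR0 : 0 < R := lt_min (hρ.trans_le hρT) (by positivity)
      have hRT : R ≤ T' := min_le_left _ _
      have hfa : AnalyticAt ℂ f z₀ := hya.congr hfy.symm
      obtain ⟨F, hF, hFf⟩ := IsPainleveISolutionAt.exists_extension hR0 hr hf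
        (S := {b ∈ ball z₀ R |
          ∀ s ∈ Set.Icc (0 : ℝ) 1, AnalyticAt ℂ f (z₀ + s * (b - z₀))})
        (fun b hb => hb.1)
        (fun z hz => by
          obtain ⟨b, hb, hbz, hbs⟩ := exists_segment_analyticAt hf hfa hz (half_pos hr)
          exact ⟨b, ⟨hb, hbs⟩, hbz⟩)
        (by
          rintro b ⟨hb, hbs⟩
          have hseg : ∀ s ∈ Set.Icc (0 : ℝ) 1, ‖s * (b - z₀)‖ < R := fun s hs => by
            rw [norm_mul, Complex.norm_real, Real.norm_of_nonneg hs.1]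
            rw [mem_ball, dist_eq_norm] at hb
            exact (mul_le_of_le_one_left (norm_nonneg _) hs.2).trans_lt hb
          have hsegb : ∀ s ∈ Set.Icc (0 : ℝ) 1, z₀ + s * (b - z₀) ∈ ball z₀ R := fun s hs => by
            rw [mem_ball, dist_eq_norm, add_sub_cancel_left]
            exact hseg s hs
          have hM : ∀ s ∈ Set.Icc (0 : ℝ) 1, ‖z₀ + s * (b - z₀)‖ ≤ ‖z₀‖ + T' := fun s hs =>
            (norm_add_le _ _).trans (by linarith [hseg s hs])
          have hV := norm_painleveEnergy_le_gronwallBound (f := f) (z₀ := z₀) (d := b - z₀)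
            (M := ‖z₀‖ + T') (T := T') (by simpa using ((hseg 1 (by simp)).le.trans hRT)) hbs
            (fun s hs => (hf _ (hsegb s hs)).deriv_deriv (hbs s hs)) hM
          rw [hfy.eq_of_nhds, hfy.deriv_eq, add_sub_cancel] at hV
          obtain ⟨g, hg, hga, hg0, hg1⟩ := hloc b (f b) (deriv f b)
            (by simpa using hM 1 (by simp)) hV
          refine ⟨g, hg, eventuallyEq_of_initial ?_ ?_ ?_ hga hg0.symm hg1.symm⟩
          · filter_upwards [isOpen_ball.mem_nhds hb] with w hw using hf w hw
          · filter_upwards [ball_mem_nhds b hr] with w hw using hg w hw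
          · simpa using hbs 1 (by simp))
      refine ⟨F, fun z hz => hF z (ball_subset_ball ?_ hz), ?_⟩
      · rw [hR, min_add]
        refine min_le_min (by linarith) ?_
        push_cast
        linarith
      · filter_upwards [ball_mem_nhds z₀ hR0, hfy] with w hw hw'
        rw [hFf hw, hw']
  obtain ⟨n, hn⟩ := exists_nat_gt (T' / (r / 2))
  rw [div_lt_iff₀ (half_pos hr)] at hn
  obtain ⟨f, hf, hfy⟩ := key n
  exact ⟨f, fun z hz => hf z (ball_subset_ball (le_min (le_max_left _ _)
    (by linarith [le_max_left T ρ])) hz), hfy⟩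

/-- A local solution extends to a meromorphic solution on the complex plane. -/
theorem IsPainleveISolutionAt.exists_global {y : ℂ → ℂ} {z₀ : ℂ} (hya : AnalyticAt ℂ y z₀)
    (hy : ∀ᶠ z in 𝓝 z₀, IsPainleveISolutionAt y z) :
    ∃ Y : ℂ → ℂ, (∀ z, IsPainleveISolutionAt Y z) ∧ Y =ᶠ[𝓝 z₀] y := by
  choose f hf hfy using fun n : ℕ => exists_on_ball hya hy (n + 1)
  have hpos : ∀ n : ℕ, (0 : ℝ) < n + 1 := fun n => by positivity
  obtain ⟨F, hF, hFs⟩ := IsPainleveISolutionAt.exists_glue (fun n : ℕ => ball z₀ (n + 1)) f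
    (fun _ => isOpen_ball) hf (fun m n z hzm hzn =>
      eqOn_of_isPreconnected ((convex_ball z₀ _).inter (convex_ball z₀ _)).isPreconnected
        (fun w hw => hf m w hw.1) (fun w hw => hf n w hw.2)
        ⟨mem_ball_self (hpos m), mem_ball_self (hpos n)⟩ ((hfy m).trans (hfy n).symm) ⟨hzm, hzn⟩)
  refine ⟨F, fun z => hFs z ?_, ?_⟩
  · obtain ⟨n, hn⟩ := exists_nat_gt (dist z z₀)
    exact ⟨n, mem_ball.2 (by linarith)⟩
  · filter_upwards [ball_mem_nhds z₀ (hpos 0), hfy 0] with w hw hw'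
    rw [hF 0 hw, hw']

/-- The Painlevé property of the first Painlevé equation. -/
theorem IsPainleveISolutionOn.exists_meromorphic_extension {U : Set ℂ} {y : ℂ → ℂ}
    (hU : IsOpen U) (hUc : IsConnected U) (hy : IsPainleveISolutionOn y U) :
    ∃ Y : ℂ → ℂ, Meromorphic Y ∧ Set.EqOn Y y U ∧
      IsPainleveISolutionOn Y {z : ℂ | AnalyticAt ℂ Y z} ∧
      ∀ p : ℂ, ¬ AnalyticAt ℂ Y p → meromorphicOrderAt Y p = ((-2 : ℤ) : WithTop ℤ) := by
  have hyU : ∀ z ∈ U, IsPainleveISolutionAt y z := fun z hz => Or.inl ⟨hy.1 z hz, hy.2 z hz⟩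
  obtain ⟨z₀, hz₀⟩ := hUc.nonempty
  obtain ⟨Y, hY, hYy⟩ := IsPainleveISolutionAt.exists_global (hy.1 z₀ hz₀)
    (by filter_upwards [hU.mem_nhds hz₀] with w hw using hyU w hw)
  exact ⟨Y, fun z => (hY z).meromorphicAt,
    IsPainleveISolutionAt.eqOn_of_isPreconnected hUc.isPreconnected (fun z _ => hY z) hyU hz₀ hYy,
    ⟨fun z hz => hz, fun z hz => (hY z).deriv_deriv hz⟩,
    fun p hp => (hY p).meromorphicOrderAt_eq hp⟩

/-! ### Solutions with a double pole and the free Laurent coefficient. -/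

theorem exists_eventuallyEq_pow_succ_mul {f g : ℂ → ℂ} {p : ℂ} {n : ℕ} (hf : AnalyticAt ℂ f p)
    (h0 : f p = 0) (hg : AnalyticAt ℂ g p)
    (h : ∀ᶠ z in 𝓝 p, deriv f z = (z - p) ^ n * g z) :
    ∃ k : ℂ → ℂ, AnalyticAt ℂ k p ∧ ∀ᶠ z in 𝓝 p, f z = (z - p) ^ (n + 1) * k z := by
  have h1 : (n : ℕ∞) ≤ analyticOrderAt (deriv f) p :=
    (natCast_le_analyticOrderAt hf.deriv).2 ⟨g, hg, by simpa using h⟩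
  have h2 : ((n + 1 : ℕ) : ℕ∞) ≤ analyticOrderAt f p := by
    have h3 := hf.analyticOrderAt_deriv_add_one
    simp only [h0, sub_zero] at h3
    rw [← h3]
    push_cast
    gcongr
  simpa using (natCast_le_analyticOrderAt hf).1 h2

theorem iteratedDeriv_eq_zero_of_eventuallyEq {f g : ℂ → ℂ} {p : ℂ} {m n : ℕ}
    (hg : AnalyticAt ℂ g p) (h : ∀ᶠ z in 𝓝 p, f z = (z - p) ^ n * g z) (hmn : m < n) :
    iteratedDeriv m f p = 0 := by
  have hf : AnalyticAt ℂ f p := by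
    have : AnalyticAt ℂ (fun z => (z - p) ^ n * g z) p := by fun_prop
    exact this.congr (EventuallyEq.symm h)
  exact (natCast_le_analyticOrderAt_iff_iteratedDeriv_eq_zero hf).1
    ((natCast_le_analyticOrderAt hf).2 ⟨g, hg, by simpa using h⟩) m hmn

theorem deriv_sum_sub_pow (p : ℂ) (a : ℕ → ℂ) (n : ℕ) :
    deriv (fun z => ∑ i ∈ Finset.range (n + 1), a i * (z - p) ^ i) =
      fun z => ∑ i ∈ Finset.range n, ((i + 1 : ℕ) * a (i + 1)) * (z - p) ^ i := by
  funext z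
  have h : HasDerivAt (fun z => ∑ i ∈ Finset.range (n + 1), a i * (z - p) ^ i)
      (∑ i ∈ Finset.range (n + 1), a i * (i * (z - p) ^ (i - 1) * 1)) z :=
    HasDerivAt.fun_sum fun i _ => (((hasDerivAt_id z).sub_const p).pow i).const_mul (a i)
  rw [h.deriv, Finset.sum_range_succ']
  simp only [Nat.cast_zero, zero_mul, mul_zero, add_zero, Nat.add_sub_cancel]
  exact Finset.sum_congr rfl fun i _ => by ring

theorem iteratedDeriv_sum_sub_pow (p : ℂ) (a : ℕ → ℂ) (n : ℕ) :
    iteratedDeriv n (fun z => ∑ i ∈ Finset.range (n + 1), a i * (z - p) ^ i) p =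
      n.factorial * a n := by
  induction n generalizing a with
  | zero => simp
  | succ n ih =>
    rw [iteratedDeriv_succ', deriv_sum_sub_pow, ih, Nat.factorial_succ]
    push_cast
    ring

section DoublePole

variable {p : ℂ} {A B : ℂ → ℂ}

/-- The equation satisfied by `A = (z - p)² y` for a solution `y`. -/
theorem IsPainleveISolutionNearPole.eventually_euler (h : IsPainleveISolutionNearPole p A) :
    ∀ᶠ z in 𝓝[≠] p, (z - p) ^ 2 * deriv (deriv A) z - 4 * ((z - p) * deriv A z) + 6 * A z =
      6 * A z ^ 2 + (z - p) ^ 4 * z := by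
  obtain ⟨hA, r, hr, -, hode⟩ := h
  have hd : ∀ z, AnalyticAt ℂ A z → z ≠ p → HasDerivAt (fun z => A z / (z - p) ^ 2)
      (deriv A z / (z - p) ^ 2 - 2 * A z / (z - p) ^ 3) z := fun z hz hzp => by
    have hne : z - p ≠ 0 := sub_ne_zero.2 hzp
    refine (hz.differentiableAt.hasDerivAt.div (((hasDerivAt_id z).sub_const p).pow 2)
      (pow_ne_zero 2 hne)).congr_deriv ?_
    simp only [id, Pi.pow_apply]
    field_simp
    ring
  filter_upwards [self_mem_nhdsWithin, nhdsWithin_le_nhds hA.eventually_analyticAt,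
    nhdsWithin_le_nhds (ball_mem_nhds p hr)] with z hzp hzA hzr
  have hzp' : z ≠ p := hzp
  have hne : z - p ≠ 0 := sub_ne_zero.2 hzp'
  have h1 : deriv (fun z => A z / (z - p) ^ 2) =ᶠ[𝓝 z]
      fun z => deriv A z / (z - p) ^ 2 - 2 * A z / (z - p) ^ 3 := by
    filter_upwards [hzA.eventually_analyticAt, isOpen_ne.mem_nhds hzp'] with w hw hwp
    exact (hd w hw hwp).deriv
  have h2 := (hzA.deriv.differentiableAt.hasDerivAt.div (((hasDerivAt_id z).sub_const p).pow 2)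
    (pow_ne_zero 2 hne)).sub ((hzA.differentiableAt.hasDerivAt.const_mul 2).div
    (((hasDerivAt_id z).sub_const p).pow 3) (pow_ne_zero 3 hne))
  have h3 := hode z ⟨hzr, hzp⟩
  rw [h1.deriv_eq] at h3
  replace h3 := (HasDerivAt.deriv h2).symm.trans h3
  simp only [id, Pi.pow_apply] at h3
  field_simp at h3
  refine mul_left_cancel₀ (pow_ne_zero 2 hne) ?_
  push_cast at h3
  linear_combination h3

/-- Letting `z → p` in the Euler form of the equation leaves `6 A(p) = 6 A(p)²`. -/
theorem IsPainleveISolutionNearPole.apply_eq_one (h : IsPainleveISolutionNearPole p A)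
    (h0 : A p ≠ 0) : A p = 1 := by
  have hA := h.1
  have h1 : Tendsto (fun z => (z - p) ^ 2 * deriv (deriv A) z - 4 * ((z - p) * deriv A z)
      + 6 * A z) (𝓝[≠] p) (𝓝 ((p - p) ^ 2 * deriv (deriv A) p - 4 * ((p - p) * deriv A p)
      + 6 * A p)) := by
    have c1 := hA.continuousAt
    have c2 := hA.deriv.continuousAt
    have c3 := hA.deriv.deriv.continuousAt
    refine Tendsto.mono_left (ContinuousAt.tendsto (f := fun z => (z - p) ^ 2 * deriv (deriv A) z
      - 4 * ((z - p) * deriv A z) + 6 * A z) ?_) nhdsWithin_le_nhds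
    fun_prop
  have h2 : Tendsto (fun z => 6 * A z ^ 2 + (z - p) ^ 4 * z) (𝓝[≠] p)
      (𝓝 (6 * A p ^ 2 + (p - p) ^ 4 * p)) := by
    have c1 := hA.continuousAt
    refine Tendsto.mono_left (ContinuousAt.tendsto (f := fun z => 6 * A z ^ 2 + (z - p) ^ 4 * z)
      ?_) nhdsWithin_le_nhds
    fun_prop
  have h3 := tendsto_nhds_unique (h1.congr' h.eventually_euler) h2
  simp only [sub_self] at h3
  refine mul_left_cancel₀ h0 ?_
  linear_combination (-1 / 6) * h3

/-- A solution with a double pole is determined by the sixth derivative of `(z - p)² y`. -/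
theorem IsPainleveISolutionNearPole.eventuallyEq (hA : IsPainleveISolutionNearPole p A)
    (hB : IsPainleveISolutionNearPole p B) (hA0 : A p ≠ 0) (hB0 : B p ≠ 0)
    (h6 : iteratedDeriv 6 A p = iteratedDeriv 6 B p) : ∀ᶠ z in 𝓝 p, A z = B z := by
  have hA1 := hA.apply_eq_one hA0
  have hB1 := hB.apply_eq_one hB0
  have hD : AnalyticAt ℂ (fun z => A z - B z) p := hA.1.fun_sub hB.1
  have hβ : ContinuousAt (fun z => 6 - 6 * (A z + B z)) p := by
    have := hA.1.continuousAt
    have := hB.1.continuousAt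
    fun_prop
  have hd : ∀ᶠ z in 𝓝 p, deriv (fun z => A z - B z) z = deriv A z - deriv B z := by
    filter_upwards [hA.1.eventually_analyticAt, hB.1.eventually_analyticAt] with z h2 h3
    exact deriv_fun_sub h2.differentiableAt h3.differentiableAt
  have hode : ∀ᶠ z in 𝓝[≠] p, (z - p) ^ 2 * deriv (deriv (fun z => A z - B z)) z
      + (-4) * ((z - p) * deriv (fun z => A z - B z) z)
      + (fun z => 6 - 6 * (A z + B z)) z * (fun z => A z - B z) z = 0 := by
    filter_upwards [hA.eventually_euler, hB.eventually_euler,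
      nhdsWithin_le_nhds hA.1.eventually_analyticAt,
      nhdsWithin_le_nhds hB.1.eventually_analyticAt, nhdsWithin_le_nhds hd,
      nhdsWithin_le_nhds (EventuallyEq.deriv hd)] with z h1 h2 h3 h4 h5 h6
    rw [h6, h5, deriv_fun_sub h3.deriv.differentiableAt h4.deriv.differentiableAt]
    linear_combination h1 - h2
  rcases eventually_eq_zero_or_indicial hD hβ hode with h | ⟨m, hm, hi⟩
  · filter_upwards [h] with z hz using sub_eq_zero.1 hz
  · exfalso
    -- Here `α = -4` and `β p = 6 - 12`, so the indicial polynomial is `m² - 5m - 6`.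
    have h1 : ((m : ℂ) - 6) * ((m + 1 : ℕ) : ℂ) = 0 := by
      rw [hA1, hB1] at hi
      push_cast
      linear_combination hi
    have hm6 : m = 6 := by
      rcases mul_eq_zero.1 h1 with h | h
      · exact_mod_cast sub_eq_zero.1 h
      · exact absurd h (Nat.cast_ne_zero.2 m.succ_ne_zero)
    subst hm6
    have h2 := (natCast_le_analyticOrderAt_iff_iteratedDeriv_eq_zero hD).1 hm.ge
    have h3 : ((7 : ℕ) : ℕ∞) ≤ analyticOrderAt (fun z => A z - B z) p := by
      rw [natCast_le_analyticOrderAt_iff_iteratedDeriv_eq_zero hD]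
      intro i hi
      rcases Nat.lt_succ_iff_lt_or_eq.1 hi with h | rfl
      · exact h2 i h
      · rw [iteratedDeriv_fun_sub hA.1.contDiffAt hB.1.contDiffAt, h6, sub_self]
    rw [hm] at h3
    exact absurd (Nat.cast_le.1 h3) (by norm_num)

/-- The expansion at a pole of the first coordinate of a solution in the pole coordinates. -/
theorem exists_expansion_of_poleField {u v : ℂ → ℂ} (hu : AnalyticAt ℂ u p)
    (hv : AnalyticAt ℂ v p) (h0 : u p = 0)
    (h : ∀ᶠ z in 𝓝 p, deriv u z = 1 + u z ^ 4 * painlevePoleFactor z (u z) (v z)) :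
    ∃ R : ℂ → ℂ, AnalyticAt ℂ R p ∧ ∀ᶠ z in 𝓝 p, u z = (z - p) + p * (z - p) ^ 5 / 20
      + (z - p) ^ 6 / 12 + v p * (z - p) ^ 7 / 7 + (z - p) ^ 8 * R z := by
  obtain ⟨s, hs, hus⟩ := (natCast_le_analyticOrderAt (n := 1) hu).1 (by
    rw [natCast_le_analyticOrderAt_iff_iteratedDeriv_eq_zero hu]
    intro i hi
    obtain rfl : i = 0 := by omega
    simpa using h0)
  simp only [smul_eq_mul] at hus
  obtain ⟨v₁, hv₁, hvv⟩ := (natCast_le_analyticOrderAt (n := 1)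
    (hv.fun_sub (analyticAt_const (v := v p)))).1 (by
      rw [natCast_le_analyticOrderAt_iff_iteratedDeriv_eq_zero
        (hv.fun_sub (analyticAt_const (v := v p)))]
      intro i hi
      obtain rfl : i = 0 := by omega
      simp)
  simp only [smul_eq_mul] at hvv
  have hk : AnalyticAt ℂ (fun z => painlevePoleFactor z (u z) (v z)) p := by
    unfold painlevePoleFactor
    fun_prop
  obtain ⟨R, hR, huR⟩ := exists_eventuallyEq_pow_succ_mul (n := 4) (f := fun z => u z - (z - p))
    (g := fun z => s z ^ 4 * painlevePoleFactor z (u z) (v z)) (by fun_prop) (by simp [h0])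
    (by fun_prop) (by
      filter_upwards [h, hus, hu.eventually_analyticAt] with z hz hz' hza
      have hd : HasDerivAt (fun z => u z - (z - p)) (deriv u z - 1) z :=
        hza.differentiableAt.hasDerivAt.sub ((hasDerivAt_id z).sub_const p)
      rw [hd.deriv, hz]
      nth_rewrite 1 [hz']
      ring)
  -- Bootstrap: inserting `u = (z - p) + (z - p)⁵ R` into `u' = 1 + u⁴k` gives `1 + (z - p)⁴ (p / 4
  -- + (z - p) / 2 + v(p) (z - p)²)` up to order 7, which is then integrated.
  obtain ⟨Q, hQ, huQ⟩ := exists_eventuallyEq_pow_succ_mul (n := 7) (f := fun z => u z -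
      ((z - p) + p * (z - p) ^ 5 / 20 + (z - p) ^ 6 / 12 + v p * (z - p) ^ 7 / 7))
    (g := fun z => (z - p) * R z * (4 + 6 * ((z - p) ^ 4 * R z) + 4 * ((z - p) ^ 4 * R z) ^ 2
        + ((z - p) ^ 4 * R z) ^ 3) * painlevePoleFactor z (u z) (v z)
      + ((z - p) ^ 2 * R z / 4 + (z - p) ^ 3 * (2 * R z + (z - p) ^ 4 * R z ^ 2) * v z + v₁ z))
    (by fun_prop) (by simp [h0]) (by fun_prop) (by
      filter_upwards [h, huR, hvv, hu.eventually_analyticAt] with z hz hzR hzv hza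
      have hd := hza.differentiableAt.hasDerivAt.sub
        ((((hasDerivAt_id z).sub_const p).add
          (((((hasDerivAt_id z).sub_const p).pow 5).const_mul p).div_const 20)).add
          ((((hasDerivAt_id z).sub_const p).pow 6).div_const 12) |>.add
          (((((hasDerivAt_id z).sub_const p).pow 7).const_mul (v p)).div_const 7))
      refine (HasDerivAt.deriv hd).trans ?_
      rw [hz]
      have e1 : u z = (z - p) + (z - p) ^ 5 * R z := by linear_combination hzR
      have e2 : v z = v p + (z - p) * v₁ z := by linear_combination hzv
      simp only [painlevePoleFactor, id]
      rw [e1, e2]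
      push_cast
      ring)
  exact ⟨Q, hQ, by filter_upwards [huQ] with z hz; linear_combination hz⟩

/-- Every point is a double pole of a solution with prescribed fourth Laurent coefficient. -/
theorem exists_isPainleveISolutionNearPole (p c : ℂ) :
    ∃ A : ℂ → ℂ, IsPainleveISolutionNearPole p A ∧ A p = 1 ∧
      iteratedDeriv 6 A p = (Nat.factorial 6 : ℂ) * c := by
  -- The term `v(p) (z - p)⁷ / 7` of `u` contributes `-2 v(p) / 7` to the coefficient of `(z - p)⁴`
  -- in `u⁻²`; hence the initial value `v(p) = -7c / 2`.
  obtain ⟨r, hr, H⟩ := exists_uniform_radius_hasDerivAt contDiff_painlevePoleField ‖p‖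
    ‖((0 : ℂ), -7 * c / 2)‖
  obtain ⟨w, hw0, hw⟩ := H p (0, -7 * c / 2) le_rfl le_rfl
  set u : ℂ → ℂ := fun z => (w z).1 with hu
  set v : ℂ → ℂ := fun z => (w z).2 with hv
  have hu' : ∀ z ∈ ball p r, HasDerivAt u (1 + u z ^ 4 * painlevePoleFactor z (u z) (v z)) z :=
    fun z hz => (hw z hz).fst
  have hv' : ∀ z ∈ ball p r, HasDerivAt v (-u z * painlevePoleFactor z (u z) (v z) *
    (z / 4 + u z / 2 + 3 * u z ^ 2 * v z)) z := fun z hz => (hw z hz).snd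
  have hu0 : u p = 0 := by simp [hu, hw0]
  have hv0 : v p = -7 * c / 2 := by simp [hv, hw0]
  have hball : ball p r ∈ 𝓝 p := ball_mem_nhds p hr
  have hud : DifferentiableOn ℂ u (ball p r) :=
    fun z hz => (hu' z hz).differentiableAt.differentiableWithinAt
  have hvd : DifferentiableOn ℂ v (ball p r) :=
    fun z hz => (hv' z hz).differentiableAt.differentiableWithinAt
  have hsa : AnalyticAt ℂ (dslope u p) p :=
    ((Complex.differentiableOn_dslope hball).2 hud).analyticAt hball
  have hs1 : dslope u p p = 1 := by
    rw [dslope_same, (hu' p (mem_ball_self hr)).deriv, hu0]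
    simp
  have hus : ∀ z, u z = (z - p) * dslope u p z := fun z => by
    have := sub_smul_dslope u p z
    rw [hu0, sub_zero, smul_eq_mul] at this
    exact this.symm
  have hAa : AnalyticAt ℂ (fun z => (dslope u p z ^ 2)⁻¹) p :=
    (hsa.pow 2).inv (by simp [-dslope_same, hs1])
  refine ⟨fun z => (dslope u p z ^ 2)⁻¹, ⟨hAa, ?_⟩, by simp [-dslope_same, hs1], ?_⟩
  · have hev : ∀ᶠ z in 𝓝 p, z ∈ ball p r ∧ dslope u p z ≠ 0 :=
      (eventually_mem_set.2 hball).and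
        (hsa.continuousAt.eventually_ne (by rw [hs1]; exact one_ne_zero))
    obtain ⟨ε, hε, hεs⟩ := Metric.eventually_nhds_iff_ball.1 hev
    have hfun : (fun z => (dslope u p z ^ 2)⁻¹ / (z - p) ^ 2) = fun z => (u z ^ 2)⁻¹ := by
      funext z
      rw [hus z, mul_pow, mul_inv, div_eq_mul_inv, mul_comm]
    refine ⟨ε, hε, ?_⟩
    rw [hfun]
    have key : ∀ z ∈ ball p ε \ {p}, AnalyticAt ℂ (fun z => (u z ^ 2)⁻¹) z ∧
        IsPainleveISolutionAt (fun z => (u z ^ 2)⁻¹) z := fun z hz => by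
      have hzr := (hεs z hz.1).1
      have hne : u z ≠ 0 := by
        rw [hus z]
        exact mul_ne_zero (sub_ne_zero.2 hz.2) (hεs z hz.1).2
      exact ⟨((hud.analyticAt (isOpen_ball.mem_nhds hzr)).pow 2).inv (pow_ne_zero 2 hne),
        IsPainleveISolutionAt.of_poleField isOpen_ball hu' hv' hzr⟩
    exact ⟨fun z hz => (key z hz).1, fun z hz => (key z hz).2.deriv_deriv (key z hz).1⟩
  · obtain ⟨R, hR, huR⟩ := exists_expansion_of_poleField (hud.analyticAt hball)
      (hvd.analyticAt hball) hu0 (by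
        filter_upwards [hball] with z hz using (hu' z hz).deriv)
    set e : ℂ → ℂ := fun z => p / 20 + (z - p) / 12 - c / 2 * (z - p) ^ 2 with he
    have hea : AnalyticAt ℂ e p := by fun_prop
    have hsR : ∀ᶠ z in 𝓝 p, dslope u p z = 1 + (z - p) ^ 4 * e z + (z - p) ^ 7 * R z := by
      have hpunct : ∀ᶠ z in 𝓝[≠] p,
          dslope u p z = 1 + (z - p) ^ 4 * e z + (z - p) ^ 7 * R z := by
        filter_upwards [self_mem_nhdsWithin, nhdsWithin_le_nhds huR] with z hz hzR
        refine mul_left_cancel₀ (sub_ne_zero.2 hz) ?_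
        rw [← hus z, hzR, hv0, he]
        ring
      exact eventuallyEq_nhds_of_eventuallyEq_nhdsNE hpunct (by simp [-dslope_same, hs1])
    -- The Taylor coefficients of `A` up to degree 6.
    set a : ℕ → ℂ := fun i => if i = 0 then 1 else if i = 4 then -p / 10 else
      if i = 5 then -1 / 6 else if i = 6 then c else 0 with haa
    have hsum : ∀ z, ∑ i ∈ Finset.range (6 + 1), a i * (z - p) ^ i
        = 1 - 2 * ((z - p) ^ 4 * e z) := fun z => by
      simp only [Finset.sum_range_succ, Finset.sum_range_zero, haa, he]
      norm_num
      ring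
    have hdiff : iteratedDeriv 6 (fun z => (dslope u p z ^ 2)⁻¹
        - ∑ i ∈ Finset.range (6 + 1), a i * (z - p) ^ i) p = 0 := by
      -- The cofactor comes from `1 - (1 - 2x)(1 + x)² = x² (3 + 2x)` with `x = (z - p)⁴ e`,
      -- together with the terms containing `R`.
      refine iteratedDeriv_eq_zero_of_eventuallyEq (n := 7)
        (g := fun z => ((z - p) * e z ^ 2 * (3 + 2 * ((z - p) ^ 4 * e z))
          - (1 - 2 * ((z - p) ^ 4 * e z)) * (2 * (1 + (z - p) ^ 4 * e z) * R z
          + (z - p) ^ 7 * R z ^ 2)) * (dslope u p z ^ 2)⁻¹) (by fun_prop) ?_ (by norm_num)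
      filter_upwards [hsR, hsa.continuousAt.eventually_ne
        (by rw [hs1]; exact one_ne_zero : dslope u p p ≠ 0)] with z hz hne
      have h2 : dslope u p z ^ 2 ≠ 0 := pow_ne_zero 2 hne
      rw [hsum z]
      refine mul_right_cancel₀ h2 ?_
      rw [sub_mul, inv_mul_cancel₀ h2, mul_assoc, mul_assoc, inv_mul_cancel₀ h2, hz]
      ring
    have hPa : AnalyticAt ℂ (fun z => ∑ i ∈ Finset.range (6 + 1), a i * (z - p) ^ i) p := by
      fun_prop
    rw [iteratedDeriv_fun_sub hAa.contDiffAt hPa.contDiffAt, iteratedDeriv_sum_sub_pow,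
      sub_eq_zero] at hdiff
    rw [hdiff]
    simp [haa]

end DoublePole

theorem mainTheorem2 :
    -- every solution on a domain extends to a meromorphic solution on `ℂ`, whose only
    -- singularities are poles of order two
    (∀ (U : Set ℂ) (y : ℂ → ℂ), IsOpen U → IsConnected U → IsPainleveISolutionOn y U →
      ∃ Y : ℂ → ℂ, Meromorphic Y ∧ Set.EqOn Y y U ∧
        IsPainleveISolutionOn Y {z : ℂ | AnalyticAt ℂ Y z} ∧
        ∀ p : ℂ, ¬ AnalyticAt ℂ Y p → meromorphicOrderAt Y p = ((-2 : ℤ) : WithTop ℤ)) ∧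
    -- at every point there is a one-parameter family of solutions with a double pole, the
    -- parameter being the coefficient of `(z - p) ^ 4`
    (∀ p c : ℂ, ∃ A : ℂ → ℂ, IsPainleveISolutionNearPole p A ∧ A p = 1 ∧
      iteratedDeriv 6 A p = (Nat.factorial 6 : ℂ) * c) ∧
    -- a solution with a double pole is determined by the pole and that coefficient
    (∀ (p : ℂ) (A B : ℂ → ℂ), IsPainleveISolutionNearPole p A → IsPainleveISolutionNearPole p B →
      A p ≠ 0 → B p ≠ 0 → iteratedDeriv 6 A p = iteratedDeriv 6 B p →
      ∀ᶠ z in nhds p, A z = B z) :=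
  ⟨fun _ _ hU hUc hy => hy.exists_meromorphic_extension hU hUc,
    exists_isPainleveISolutionNearPole,
    fun _ _ _ hA hB hA0 hB0 h6 => hA.eventuallyEq hB hA0 hB0 h6⟩
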